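/- Let $\mathcal H$ be a real separable infinite-dimensional Hilbert space, and let $\mathcal N(m,C)$ denote the Gaussian measure on $\mathcal H$ with mean $m$ and covariance operator $C$. Let $\mu_*=\mathcal N(m_*,C_*)$, where $C_*$ is self-adjoint, trace class and strictly positive ($\langle x,C_*x\rangle>0$ for $x\neq0$). For $i=0,1$ let $\mu_i=\mathcal N(m_i,C_i)$ be a Gaussian measure equivalent to $\mu_*$ (mutually absolutely continuous), with $$C_i=C_*^{1/2}(I-S_i)C_*^{1/2},$$ where $S_i$ is self-adjoint, Hilbert--Schmidt and $I-S_i>0$ (strictly positive). Let $\alpha\in[0,1]$ and, for $\gamma>0$, put $$S_\alpha=I-[(1-\alpha)(I-S_0)^{-1}+\alpha(I-S_1)^{-1}]^{-1},\qquad C_{\alpha,\gamma}=[(1-\alpha)(C_0+\gamma I)^{-1}+\alpha(C_1+\gamma I)^{-1}]^{-1}.$$ Notation. $\det(I+A)=\prod_k(1+\lambda_k(A))$ is the Fredholm determinant of $I+A$, $A$ trace class (product over the eigenvalues of $A$ with algebraic multiplicity), and $\det_2(I+A)=\det[(I+A)\exp(-A)]$ for $A$ Hilbert--Schmidt. For $A$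 trace class and $\gamma\in\mathbb R$, $\operatorname{tr}_X(A+\gamma I)=\operatorname{tr}(A)+\gamma$ and, if $\gamma\ne0$, $\det_X(A+\gamma I)=\gamma\det(I+A/\gamma)$. $\mathscr{PC}_1(\mathcal H)$ is the set of operators $A+\gamma I$ with $A$ self-adjoint trace class and $\gamma\in\mathbb R$ which are positive definite, i.e. $\langle x,(A+\gamma I)x\rangle\ge M\|x\|^2$ for all $x$ and some $M>0$. For $A+\gamma I,\;B+\mu I\in\mathscr{PC}_1(\mathcal H)$, $$d^1_{\mathrm{logdet}}[A+\gamma I,B+\mu I]=\Big(\tfrac\gamma\mu-1\Big)\log\tfrac\gamma\mu+\operatorname{tr}_X[(B+\mu I)^{-1}(A+\gamma I)-I]-\tfrac\gamma\mu\log\det\nolimits_X[(B+\mu I)^{-1}(A+\gamma I)].$$ Then $S_\alpha$ is self-adjoint and Hilbert--Schmidt with $I-S_\alpha>0$; for every $\gamma>0$ the operators $C_{\alpha,\gamma}$, $C_0+\gamma I$ and $C_1+\gamma I$ belong to $\mathscr{PC}_1(\mathcal H)$; and for $i=0,1$, $\det_2[(I-S_\alpha)^{-1}(I-S_i)]>0$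 and $$\lim_{\gamma\to0^+}d^1_{\mathrm{logdet}}[\,C_i+\gamma I,\;C_{\alpha,\gamma}\,]=-\log\det\nolimits_2[(I-S_\alpha)^{-1}(I-S_i)].$$ -/

import Mathlib

open Filter Topology MeasureTheory ProbabilityTheory
open scoped InnerProductSpace TensorProduct

noncomputable section

namespace GeoJS

section Operators

variable {H : Type*} [NormedAddCommGroup H] [InnerProductSpace ℝ H] [CompleteSpace H]

/-! ### Positive operators, square roots -/

/-- `A ∈ Sym⁺⁺(H)`: self-adjoint and `⟪x, A x⟫ > 0` for all `x ≠ 0`. -/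
def StrictlyPositive (A : H →L[ℝ] H) : Prop :=
  IsSelfAdjoint A ∧ ∀ x : H, x ≠ 0 → 0 < ⟪x, A x⟫_ℝ

/-- `A` is positive definite: self-adjoint with `⟪x, A x⟫ ≥ M ‖x‖²` for some `M > 0`. -/
def PositiveDefinite (A : H →L[ℝ] H) : Prop :=
  IsSelfAdjoint A ∧ ∃ M : ℝ, 0 < M ∧ ∀ x : H, M * ‖x‖ ^ 2 ≤ ⟪x, A x⟫_ℝ

open Classical in
/-- The square root `A^{1/2}` of a positive operator `A`: the (unique) positive operator
whose square is `A`. Mathlib has no functional calculus for operators on real Hilbert spaces. -/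
def opSqrt (A : H →L[ℝ] H) : H →L[ℝ] H :=
  if h : ∃ R : H →L[ℝ] H, R.IsPositive ∧ R * R = A then h.choose else 0

/-- The absolute value `|A| = (A* A)^{1/2}`. -/
def opAbs (A : H →L[ℝ] H) : H →L[ℝ] H :=
  opSqrt (ContinuousLinearMap.adjoint A * A)

/-! ### Trace class and Hilbert-Schmidt operators -/

variable (H) in
/-- Index set of an orthonormal basis of `H`. -/
def onbIndex : Set H := (exists_hilbertBasis ℝ H).choose

variable (H) in
/-- An orthonormal (Hilbert) basis of `H`. The notions below do not depend on its choice. -/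
def onb : HilbertBasis (onbIndex H) ℝ H := (exists_hilbertBasis ℝ H).choose_spec.choose

/-- `A ∈ Tr(H)`: `∑ₖ ⟪eₖ, |A| eₖ⟫ < ∞`. -/
def IsTraceClass (A : H →L[ℝ] H) : Prop :=
  Summable fun k => ⟪onb H k, opAbs A (onb H k)⟫_ℝ

/-- `A ∈ HS(H)`: `∑ₖ ‖A eₖ‖² < ∞`. -/
def IsHilbertSchmidt (A : H →L[ℝ] H) : Prop :=
  Summable fun k => ‖A (onb H k)‖ ^ 2

/-- `trace(A) = ∑ₖ ⟪eₖ, A eₖ⟫`, for trace class `A`. -/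
def opTrace (A : H →L[ℝ] H) : ℝ :=
  ∑' k, ⟪onb H k, A (onb H k)⟫_ℝ

variable (H) in
/-- The set of self-adjoint Hilbert-Schmidt operators `S` with `I - S > 0`. -/
def SymHSLtOne : Set (H →L[ℝ] H) :=
  {S | IsSelfAdjoint S ∧ IsHilbertSchmidt S ∧ StrictlyPositive (1 - S)}

/-! ### Determinants -/

/-- The algebraic multiplicity of `z : ℂ` as an eigenvalue of (the complexification of) `A`:
the dimension of `⋃ₙ ker (A - z)ⁿ` (finite for `A` compact and `z ≠ 0`). -/
def algMult (A : H →L[ℝ] H) (z : ℂ) : ℕ :=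
  Module.finrank ℂ
    (Module.End.maxGenEigenspace ((A : H →ₗ[ℝ] H).baseChange ℂ : Module.End ℂ (ℂ ⊗[ℝ] H)) z)

/-- The Fredholm determinant `det(T)`, `T = I + A` with `A` trace class:
`det(I + A) = ∏ₖ (1 + λₖ(A))` over the eigenvalues of `A`, counted with algebraic multiplicity.
(Zero eigenvalues contribute `1`. Non-real eigenvalues of the real operator `A` come in conjugate
pairs, so the product is a real number.) -/
def fredholmDet (T : H →L[ℝ] H) : ℝ :=
  (∏' z : ℂ, (1 + z) ^ algMult (T - 1) z).re

/-- The Hilbert-Carleman determinant `det₂(T)`, `T = I + A` with `A` Hilbert-Schmidt: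
`det₂(I + A) = det[(I + A) exp(-A)]`. -/
def det2 (T : H →L[ℝ] H) : ℝ :=
  fredholmDet (T * NormedSpace.exp (-(T - 1)))

/-! ### Extended (unitized) trace class operators -/

/-- `T ∈ Tr_X(H)`: `T = A + γ I` with `A` trace class and `γ ∈ ℝ`. -/
def IsExtTraceClass (T : H →L[ℝ] H) : Prop :=
  ∃ γ : ℝ, IsTraceClass (T - γ • 1)

/-- `T ∈ 𝒫𝒞₁(H)`: a positive definite extended trace class operator. -/
def IsPC1 (T : H →L[ℝ] H) : Prop :=
  PositiveDefinite T ∧ IsExtTraceClass T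

open Classical in
/-- The scalar `γ` in `T = A + γ I ∈ Tr_X(H)`; it is unique when `dim H = ∞`. -/
def scalarPart (T : H →L[ℝ] H) : ℝ :=
  if h : IsExtTraceClass T then h.choose else 0

/-- The extended trace `tr_X(A + γ I) = tr(A) + γ`. -/
def extTrace (T : H →L[ℝ] H) : ℝ :=
  opTrace (T - scalarPart T • 1) + scalarPart T

/-- The extended Fredholm determinant `det_X(A + γ I) = γ det(I + A/γ)`, `γ ≠ 0`. -/
def extDet (T : H →L[ℝ] H) : ℝ :=
  scalarPart T * fredholmDet (1 + (scalarPart T)⁻¹ • (T - scalarPart T • 1))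

/-- The infinite-dimensional Log-Det divergence `d¹_logdet[P, Q]` of `P = A + γ I` and
`Q = B + μ I` in `𝒫𝒞₁(H)`:
`(γ/μ - 1) log(γ/μ) + tr_X[Q⁻¹ P - I] - (γ/μ) log det_X[Q⁻¹ P]`. -/
def logDetDiv (P Q : H →L[ℝ] H) : ℝ :=
  (scalarPart P / scalarPart Q - 1) * Real.log (scalarPart P / scalarPart Q)
    + extTrace (Ring.inverse Q * P - 1)
    - scalarPart P / scalarPart Q * Real.log (extDet (Ring.inverse Q * P))

/-! ### The interpolated operators -/

/-- `S_α = I - [(1-α)(I-S₀)⁻¹ + α(I-S₁)⁻¹]⁻¹`. -/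
def interpS (S₀ S₁ : H →L[ℝ] H) (α : ℝ) : H →L[ℝ] H :=
  1 - Ring.inverse ((1 - α) • Ring.inverse (1 - S₀) + α • Ring.inverse (1 - S₁))

/-- `C_{α,γ} = [(1-α)(C₀+γI)⁻¹ + α(C₁+γI)⁻¹]⁻¹`. -/
def interpC (C₀ C₁ : H →L[ℝ] H) (α γ : ℝ) : H →L[ℝ] H :=
  Ring.inverse ((1 - α) • Ring.inverse (C₀ + γ • 1) + α • Ring.inverse (C₁ + γ • 1))

end Operators

section Gaussian

variable {H : Type*} [NormedAddCommGroup H] [InnerProductSpace ℝ H]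
  [MeasurableSpace H] [BorelSpace H]

/-- `μ = 𝒩(m, C)`: `μ` is a Gaussian measure with mean `m` and covariance operator `C`. -/
def IsGaussianWith (μ : Measure H) (m : H) (C : H →L[ℝ] H) : Prop :=
  IsGaussian μ ∧ ∫ x, x ∂μ = m ∧ ∀ u v : H, covarianceBilin μ u v = ⟪C u, v⟫_ℝ

/-- `Gauss(H, μ_*)`: the Gaussian measures that are equivalent to `μ_*`. -/
def gaussEquiv (μs : Measure H) : Set (Measure H) :=
  {μ | IsGaussian μ ∧ μ ≪ μs ∧ μs ≪ μ}

end Gaussian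

end GeoJS

end

/-!
The case `i = 1` follows from the case `i = 0` by exchanging the indices and replacing `α` by
`1 - α`, so only `i = 0` is discussed.

*Similarity.* For `P = C₀ + γ` and `Q = C_{α,γ}` both scalar parts are `γ`, and
`Q⁻¹ P = (1 - α) + α (C₁ + γ)⁻¹ (C₀ + γ)`. Put `G = (1 - S₁)^{1/2}` and `1 + K = G⁻¹ (1 - S₀) G⁻¹`,
with `K` self-adjoint and Hilbert-Schmidt. The polar decomposition `C_*^{1/2} G = O Y`
(`exists_polar`) gives `C₁ = O Y² O⁻¹` and `C₀ = O Y (1 + K) Y O⁻¹`. With `D = (Y² + γ)^{1/2}` and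
`U = Y D⁻¹`, all diagonal in one orthonormal basis, `Q⁻¹ P = J (1 + U (α K) U) J⁻¹` for `J = O D⁻¹`.
In the same way `(1 - S_α)⁻¹ (1 - S₀) = G⁻¹ (1 + α K) G`.

*Determinants.* An operator that is similar to a self-adjoint one with eigenvalues `aᵢ` has
`fredholmDet (1 + A) = ∏ (1 + aᵢ)` (`fredholmDet_conj`): algebraic multiplicities are invariant under
similarity, and base change to `ℂ` is flat. Since the trace is cyclic on products of Hilbert-Schmidt
operators, both the divergence (`hasSum_logDetDiv`) and `-log det₂` (`det2_conj`) are sums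
`∑ (aᵢ - log (1 + aᵢ))`, over the eigenvalues of `U (α K) U` and of `α K` respectively.

*Limit.* This sum is continuous in the Hilbert-Schmidt norm on self-adjoint operators with
`1 + aᵢ ≥ c > 0` (`abs_sum_sub_log_sub_le`), by comparing two eigenbases through the doubly stochastic
weights `⟪bᵢ, b'ⱼ⟫²`. As `γ → 0⁺` the eigenvalues of `U` tend to `1`, so `U (α K) U → α K` in
Hilbert-Schmidt norm by dominated convergence (`tendsto_hsNormSq_conj`).
-/

namespace GeoJS

universe u

/-! ### Hilbert-Schmidt operators -/

section HilbertSchmidt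

variable {H : Type*} [NormedAddCommGroup H] [InnerProductSpace ℝ H] {ι ι' : Type*}

theorem hasSum_sq_inner (b : HilbertBasis ι ℝ H) (x : H) :
    HasSum (fun i => ⟪b i, x⟫_ℝ ^ 2) (‖x‖ ^ 2) := by
  have h := b.hasSum_inner_mul_inner x x
  rw [real_inner_self_eq_norm_sq] at h
  simpa only [sq, real_inner_comm] using h

theorem summable_matrix (b : HilbertBasis ι ℝ H) (b' : HilbertBasis ι' ℝ H) {A : H →L[ℝ] H}
    (h : Summable fun i => ‖A (b i)‖ ^ 2) :
    Summable fun p : ι × ι' => ⟪b' p.2, A (b p.1)⟫_ℝ ^ 2 := by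
  have h0 : (0 : ι × ι' → ℝ) ≤ fun p : ι × ι' => ⟪b' p.2, A (b p.1)⟫_ℝ ^ 2 :=
    fun p => sq_nonneg _
  refine (summable_prod_of_nonneg h0).mpr ⟨fun i => (hasSum_sq_inner b' (A (b i))).summable, ?_⟩
  exact h.congr fun i => ((hasSum_sq_inner b' (A (b i))).tsum_eq).symm

variable [CompleteSpace H]

/-- Both sides are the sum of the squared matrix entries of `A`. -/
theorem hasSum_norm_sq_adjoint (b : HilbertBasis ι ℝ H) (b' : HilbertBasis ι' ℝ H) {A : H →L[ℝ] H}
    {t : ℝ} (h : HasSum (fun i => ‖A (b i)‖ ^ 2) t) :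
    HasSum (fun j => ‖ContinuousLinearMap.adjoint A (b' j)‖ ^ 2) t := by
  have hs := summable_matrix b b' h.summable
  have h1 : HasSum (fun p : ι × ι' => ⟪b' p.2, A (b p.1)⟫_ℝ ^ 2) t := by
    have := hs.hasSum.prod_fiberwise fun i => hasSum_sq_inner b' (A (b i))
    rw [← this.unique h]
    exact hs.hasSum
  have h2 := (Equiv.prodComm ι' ι).hasSum_iff.mpr h1
  refine h2.prod_fiberwise fun j => ?_
  have := hasSum_sq_inner b (ContinuousLinearMap.adjoint A (b' j))
  simpa [ContinuousLinearMap.adjoint_inner_right, real_inner_comm] using this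

/-- The squared Hilbert-Schmidt norm; its value is `0` when `A` is not Hilbert-Schmidt. -/
noncomputable def hsNormSq (A : H →L[ℝ] H) : ℝ := ∑' k, ‖A (onb H k)‖ ^ 2

theorem hsNormSq_nonneg (A : H →L[ℝ] H) : 0 ≤ hsNormSq A :=
  tsum_nonneg fun _ => sq_nonneg _

theorem IsHilbertSchmidt.hasSum {A : H →L[ℝ] H} (hA : IsHilbertSchmidt A)
    (b : HilbertBasis ι ℝ H) : HasSum (fun i => ‖A (b i)‖ ^ 2) (hsNormSq A) := by
  have := hasSum_norm_sq_adjoint (onb H) b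
    (hasSum_norm_sq_adjoint (onb H) (onb H) (Summable.hasSum hA))
  rwa [ContinuousLinearMap.adjoint_adjoint] at this

theorem isHilbertSchmidt_of_hasSum (b : HilbertBasis ι ℝ H) {A : H →L[ℝ] H} {t : ℝ}
    (h : HasSum (fun i => ‖A (b i)‖ ^ 2) t) : IsHilbertSchmidt A ∧ hsNormSq A = t := by
  have := hasSum_norm_sq_adjoint (onb H) (onb H) (hasSum_norm_sq_adjoint b (onb H) h)
  simp only [ContinuousLinearMap.adjoint_adjoint] at this
  exact ⟨this.summable, this.tsum_eq⟩

theorem isHilbertSchmidt_of_summable (b : HilbertBasis ι ℝ H) {A : H →L[ℝ] H}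
    (h : Summable fun i => ‖A (b i)‖ ^ 2) : IsHilbertSchmidt A :=
  (isHilbertSchmidt_of_hasSum b h.hasSum).1

theorem IsHilbertSchmidt.adjoint {A : H →L[ℝ] H} (hA : IsHilbertSchmidt A) :
    IsHilbertSchmidt (ContinuousLinearMap.adjoint A) :=
  (hasSum_norm_sq_adjoint (onb H) (onb H) (Summable.hasSum hA)).summable

theorem IsHilbertSchmidt.mul_left {A : H →L[ℝ] H} (hA : IsHilbertSchmidt A) (T : H →L[ℝ] H) :
    IsHilbertSchmidt (T * A) := by
  refine Summable.of_nonneg_of_le (fun _ => sq_nonneg _) (fun k => ?_)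
    (Summable.mul_left (‖T‖ ^ 2) hA)
  rw [← mul_pow]
  exact pow_le_pow_left₀ (norm_nonneg _) (T.le_opNorm _) 2

theorem IsHilbertSchmidt.mul_right {A : H →L[ℝ] H} (hA : IsHilbertSchmidt A) (T : H →L[ℝ] H) :
    IsHilbertSchmidt (A * T) := by
  have := (hA.adjoint.mul_left (ContinuousLinearMap.adjoint T)).adjoint
  rwa [← ContinuousLinearMap.star_eq_adjoint, ← ContinuousLinearMap.star_eq_adjoint,
    ← ContinuousLinearMap.star_eq_adjoint, ← star_mul, star_star] at this

theorem IsHilbertSchmidt.add {A B : H →L[ℝ] H} (hA : IsHilbertSchmidt A)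
    (hB : IsHilbertSchmidt B) : IsHilbertSchmidt (A + B) := by
  refine Summable.of_nonneg_of_le (fun _ => sq_nonneg _) (fun k => ?_)
    (Summable.mul_left 2 (Summable.add hA hB))
  have h1 := norm_add_le (A (onb H k)) (B (onb H k))
  have h2 := norm_nonneg (A (onb H k) + B (onb H k))
  rw [add_apply]
  nlinarith [sq_nonneg (‖A (onb H k)‖ - ‖B (onb H k)‖)]

theorem IsHilbertSchmidt.smul {A : H →L[ℝ] H} (hA : IsHilbertSchmidt A) (c : ℝ) :
    IsHilbertSchmidt (c • A) := by
  simpa using hA.mul_left (c • (1 : H →L[ℝ] H))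

theorem IsHilbertSchmidt.neg {A : H →L[ℝ] H} (hA : IsHilbertSchmidt A) :
    IsHilbertSchmidt (-A) := by
  simpa using hA.smul (-1)

theorem IsHilbertSchmidt.sub {A B : H →L[ℝ] H} (hA : IsHilbertSchmidt A)
    (hB : IsHilbertSchmidt B) : IsHilbertSchmidt (A - B) := by
  rw [sub_eq_add_neg]; exact hA.add hB.neg

theorem IsHilbertSchmidt.norm_sq_le {A : H →L[ℝ] H} (hA : IsHilbertSchmidt A) :
    ‖A‖ ^ 2 ≤ hsNormSq A := by
  have key : ∀ x, ‖A x‖ ^ 2 ≤ hsNormSq A * ‖x‖ ^ 2 := fun x => by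
    have h1 := hasSum_sq_inner (onb H) (A x)
    have h2 := (hasSum_norm_sq_adjoint (onb H) (onb H) (Summable.hasSum hA)).mul_right (‖x‖ ^ 2)
    refine hasSum_le (fun k => ?_) h1 h2
    rw [← ContinuousLinearMap.adjoint_inner_left, ← mul_pow]
    exact sq_le_sq' (neg_le_of_abs_le (abs_real_inner_le_norm _ _)) (real_inner_le_norm _ _)
  have h3 : ‖A‖ ≤ √(hsNormSq A) := by
    refine A.opNorm_le_bound (Real.sqrt_nonneg _) fun x => ?_
    refine abs_le_of_sq_le_sq' ?_ (by positivity) |>.2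
    rw [mul_pow, Real.sq_sqrt (hsNormSq_nonneg A)]
    exact key x
  calc ‖A‖ ^ 2 ≤ √(hsNormSq A) ^ 2 := pow_le_pow_left₀ (norm_nonneg _) h3 2
    _ = _ := Real.sq_sqrt (hsNormSq_nonneg A)

/-- The truncations of `A` along an orthonormal basis have finite rank and converge to `A` in
norm. -/
theorem IsHilbertSchmidt.isCompactOperator {A : H →L[ℝ] H} (hA : IsHilbertSchmidt A) :
    IsCompactOperator A := by
  classical
  set b := onb H
  let F : Finset (onbIndex H) → H →L[ℝ] H := fun s =>
    ∑ i ∈ s, (innerSL ℝ (b i)).smulRight (A (b i))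
  have hF : ∀ s, IsCompactOperator (F s) := fun s => by
    have : F s ∈ compactOperator (RingHom.id ℝ) H H := by
      refine Submodule.sum_mem _ fun i _ => ?_
      change IsCompactOperator _
      have h1 : IsCompactOperator ((1 : ℝ →L[ℝ] ℝ).smulRight (A (b i))) :=
        isCompactOperator_of_locallyCompactSpace_rng _
      have h2 := h1.comp_clm (innerSL ℝ (b i))
      convert h2 using 1
      ext x
      simp
    exact this
  have hFb : ∀ s i, (A - F s) (b i) = if i ∈ s then 0 else A (b i) := fun s i => by
    simp only [F, sub_apply, sum_apply,
      ContinuousLinearMap.smulRight_apply, innerSL_apply_apply,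
      orthonormal_iff_ite.mp b.orthonormal]
    by_cases hi : i ∈ s <;> simp [hi]
  have hbound : ∀ s, ‖A - F s‖ ^ 2 ≤ hsNormSq A - ∑ i ∈ s, ‖A (b i)‖ ^ 2 := fun s => by
    have h1 : HasSum (fun i => if i ∈ s then ‖A (b i)‖ ^ 2 else 0) (∑ i ∈ s, ‖A (b i)‖ ^ 2) := by
      have := hasSum_sum_of_ne_finset_zero (f := fun i => if i ∈ s then ‖A (b i)‖ ^ 2 else 0)
        (s := s) (L := .unconditional _) (fun i hi => by simp [hi])
      rwa [Finset.sum_congr rfl (fun i hi => if_pos hi)] at this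
    have h2 : HasSum (fun i => ‖(A - F s) (b i)‖ ^ 2) (hsNormSq A - ∑ i ∈ s, ‖A (b i)‖ ^ 2) := by
      have h4 : (fun i => ‖(A - F s) (b i)‖ ^ 2) =
          fun i => ‖A (b i)‖ ^ 2 - if i ∈ s then ‖A (b i)‖ ^ 2 else 0 := by
        funext i
        rw [hFb]
        by_cases hi : i ∈ s <;> simp [hi]
      rw [h4]
      exact HasSum.sub (hA.hasSum b) h1
    obtain ⟨h3, h4⟩ := isHilbertSchmidt_of_hasSum b h2
    exact h4 ▸ h3.norm_sq_le
  have hlim : Tendsto (fun s => ‖A - F s‖ ^ 2) atTop (𝓝 0) := by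
    refine squeeze_zero (fun _ => sq_nonneg _) hbound ?_
    simpa using (tendsto_const_nhds (x := hsNormSq A)).sub (hA.hasSum b)
  have hlim2 : Tendsto F atTop (𝓝 A) := by
    rw [tendsto_iff_norm_sub_tendsto_zero]
    have := hlim.sqrt
    simpa [norm_sub_rev, Real.sqrt_sq] using this
  exact isCompactOperator_of_tendsto hlim2 (Eventually.of_forall hF)

/-- Cyclicity and basis independence of the trace of a product of two Hilbert-Schmidt operators. -/
theorem tsum_inner_mul_comm {X Y : H →L[ℝ] H} (hX : IsHilbertSchmidt X) (hY : IsHilbertSchmidt Y)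
    (b : HilbertBasis ι ℝ H) (b' : HilbertBasis ι' ℝ H) :
    ∑' i, ⟪b i, (X * Y) (b i)⟫_ℝ = ∑' j, ⟪b' j, (Y * X) (b' j)⟫_ℝ := by
  have hs : Summable fun p : ι × ι' => ⟪b p.1, X (b' p.2)⟫_ℝ * ⟪b' p.2, Y (b p.1)⟫_ℝ := by
    have h1 := (Equiv.prodComm ι ι').summable_iff.mpr (summable_matrix b' b (hX.hasSum b').summable)
    have h2 := summable_matrix b b' (hY.hasSum b).summable
    refine Summable.of_norm_bounded (h1.add h2) fun p => ?_
    simp only [Function.comp, Equiv.prodComm_apply, Prod.fst_swap, Prod.snd_swap]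
    rw [Real.norm_eq_abs, abs_mul]
    nlinarith [sq_abs ⟪b p.1, X (b' p.2)⟫_ℝ, sq_abs ⟪b' p.2, Y (b p.1)⟫_ℝ,
      sq_nonneg (|⟪b p.1, X (b' p.2)⟫_ℝ| - |⟪b' p.2, Y (b p.1)⟫_ℝ|),
      abs_nonneg ⟪b p.1, X (b' p.2)⟫_ℝ, abs_nonneg ⟪b' p.2, Y (b p.1)⟫_ℝ]
  have h1 := hs.hasSum.prod_fiberwise (g := fun i => ⟪b i, (X * Y) (b i)⟫_ℝ) fun i => by
    have := b'.hasSum_inner_mul_inner (ContinuousLinearMap.adjoint X (b i)) (Y (b i))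
    simpa [ContinuousLinearMap.adjoint_inner_left] using this
  have h2 := ((Equiv.prodComm ι' ι).hasSum_iff.mpr hs.hasSum).prod_fiberwise
    (g := fun j => ⟪b' j, (Y * X) (b' j)⟫_ℝ) fun j => by
    have := b.hasSum_inner_mul_inner (ContinuousLinearMap.adjoint Y (b' j)) (X (b' j))
    simpa [ContinuousLinearMap.adjoint_inner_left, mul_comm] using this
  rw [h1.tsum_eq, h2.tsum_eq]

end HilbertSchmidt

/-! ### Operators with an orthonormal eigenbasis -/

section Diagonal

variable {H : Type*} [NormedAddCommGroup H] [InnerProductSpace ℝ H] {ι ι' : Type*}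

/-- `A` is diagonal in the Hilbert basis `b`, with eigenvalues `a`. -/
def IsDiag (b : HilbertBasis ι ℝ H) (a : ι → ℝ) (A : H →L[ℝ] H) : Prop :=
  ∀ i, A (b i) = a i • b i

theorem ext_hilbertBasis {F : Type*} [NormedAddCommGroup F] [NormedSpace ℝ F]
    (b : HilbertBasis ι ℝ H) {A B : H →L[ℝ] F}
    (h : ∀ i, A (b i) = B (b i)) : A = B := by
  refine ContinuousLinearMap.ext_on (s := Set.range b) ?_ ?_
  · rw [dense_iff_closure_eq, ← Submodule.topologicalClosure_coe, b.dense_span]; rfl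
  · rintro _ ⟨i, rfl⟩; exact h i

theorem eq_of_forall_inner (b : HilbertBasis ι ℝ H) {x y : H}
    (h : ∀ i, ⟪b i, x⟫_ℝ = ⟪b i, y⟫_ℝ) : x = y := by
  refine b.repr.injective (lp.ext (funext fun i => ?_))
  rw [b.repr_apply_apply, b.repr_apply_apply, h]

theorem inner_basis [DecidableEq ι] (b : HilbertBasis ι ℝ H) (i j : ι) :
    ⟪b i, b j⟫_ℝ = if i = j then 1 else 0 :=
  orthonormal_iff_ite.mp b.orthonormal i j

theorem inner_basis_self (b : HilbertBasis ι ℝ H) (i : ι) : ⟪b i, b i⟫_ℝ = 1 := by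
  classical rw [inner_basis, if_pos rfl]

theorem norm_basis (b : HilbertBasis ι ℝ H) (i : ι) : ‖b i‖ = 1 := b.orthonormal.1 i

theorem basis_ne_zero (b : HilbertBasis ι ℝ H) (i : ι) : b i ≠ 0 := b.orthonormal.ne_zero i

theorem IsDiag.mul {b : HilbertBasis ι ℝ H} {a a' : ι → ℝ} {A A' : H →L[ℝ] H}
    (h : IsDiag b a A) (h' : IsDiag b a' A') : IsDiag b (fun i => a i * a' i) (A * A') := fun i => by
  rw [mul_apply_eq_comp, h' i, map_smul, h i, smul_smul, mul_comm]

theorem IsDiag.add {b : HilbertBasis ι ℝ H} {a a' : ι → ℝ} {A A' : H →L[ℝ] H}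
    (h : IsDiag b a A) (h' : IsDiag b a' A') : IsDiag b (fun i => a i + a' i) (A + A') := fun i => by
  rw [add_apply, h' i, h i, add_smul]

theorem IsDiag.smul {b : HilbertBasis ι ℝ H} {a : ι → ℝ} {A : H →L[ℝ] H}
    (h : IsDiag b a A) (c : ℝ) : IsDiag b (fun i => c * a i) (c • A) := fun i => by
  rw [smul_apply, h i, mul_smul]

theorem IsDiag.neg {b : HilbertBasis ι ℝ H} {a : ι → ℝ} {A : H →L[ℝ] H}
    (h : IsDiag b a A) : IsDiag b (fun i => -a i) (-A) := fun i => by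
  rw [neg_apply, h i, neg_smul]

theorem isDiag_one (b : HilbertBasis ι ℝ H) : IsDiag b (fun _ => 1) (1 : H →L[ℝ] H) := fun i => by
  simp

/-- The diagonal operator with bounded eigenvalues `a` in the basis `b`. -/
theorem exists_isDiag (b : HilbertBasis ι ℝ H) {a : ι → ℝ} {M : ℝ} (ha : ∀ i, |a i| ≤ M) :
    ∃ A : H →L[ℝ] H, IsDiag b a A := by
  classical
  have hbd : ∀ x i, ⟪b i, x⟫_ℝ ^ 2 * a i ^ 2 ≤ ⟪b i, x⟫_ℝ ^ 2 * M ^ 2 := fun x i => by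
    refine mul_le_mul_of_nonneg_left ?_ (sq_nonneg _)
    rw [← sq_abs]
    exact pow_le_pow_left₀ (abs_nonneg _) (ha i) 2
  have hmem : ∀ x : H, Memℓp (fun i => a i * ⟪b i, x⟫_ℝ) 2 := fun x => by
    refine memℓp_gen ?_
    refine Summable.of_nonneg_of_le (fun i => by positivity) (fun i => ?_)
      ((hasSum_sq_inner b x).summable.mul_right (M ^ 2))
    have := hbd x i
    simp only [Real.norm_eq_abs, ENNReal.toReal_ofNat, Real.rpow_ofNat, sq_abs, mul_pow]
    linarith
  let f : H →ₗ[ℝ] H :=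
    { toFun := fun x => b.repr.symm ⟨fun i => a i * ⟪b i, x⟫_ℝ, hmem x⟩
      map_add' := fun x y => by
        rw [← map_add]
        congr 1
        ext i
        exact (congrArg (a i * ·) (inner_add_right _ _ _)).trans (mul_add _ _ _)
      map_smul' := fun c x => by
        rw [RingHom.id_apply, ← map_smul]
        congr 1
        ext i
        simp [inner_smul_right]
        ring }
  have hf : ∀ x i, ⟪b i, f x⟫_ℝ = a i * ⟪b i, x⟫_ℝ := fun x i => by
    rw [← b.repr_apply_apply]
    simp [f]
  refine ⟨f.mkContinuous |M| fun x => ?_, fun i => ?_⟩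
  · refine abs_le_of_sq_le_sq' ?_ (by positivity) |>.2
    rw [mul_pow, sq_abs]
    have h1 := hasSum_sq_inner b (f x)
    have h2 := (hasSum_sq_inner b x).mul_right (M ^ 2)
    rw [mul_comm]
    refine hasSum_le (fun i => ?_) h1 h2
    have := hbd x i
    rw [hf, mul_pow]
    linarith
  · refine eq_of_forall_inner b fun j => ?_
    rw [LinearMap.mkContinuous_apply, hf, inner_smul_right, inner_basis]
    split_ifs with h
    · rw [h]
    · simp

theorem IsDiag.inner_apply {b : HilbertBasis ι ℝ H} {a : ι → ℝ} {A : H →L[ℝ] H}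
    (h : IsDiag b a A) (i : ι) (x : H) : ⟪b i, A x⟫_ℝ = a i * ⟪b i, x⟫_ℝ := by
  classical
  have : (innerSL ℝ (b i)) ∘L A = a i • innerSL ℝ (b i) := by
    refine ext_hilbertBasis b fun j => ?_
    simp only [ContinuousLinearMap.comp_apply, innerSL_apply_apply, h j,
      smul_apply, inner_smul_right, inner_basis, smul_eq_mul]
    split_ifs with h
    · rw [h]
    · simp
  simpa using congrArg (fun T => T x) this

theorem IsDiag.eigenvalue_eq {b : HilbertBasis ι ℝ H} {a : ι → ℝ} {A : H →L[ℝ] H}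
    (h : IsDiag b a A) (i : ι) : a i = ⟪b i, A (b i)⟫_ℝ := by
  rw [h i, inner_smul_right, inner_basis_self, mul_one]

theorem IsDiag.abs_le {b : HilbertBasis ι ℝ H} {a : ι → ℝ} {A : H →L[ℝ] H}
    (h : IsDiag b a A) (i : ι) : |a i| ≤ ‖A‖ := by
  have := A.le_opNorm (b i)
  rwa [h i, norm_smul, norm_basis, mul_one, mul_one] at this

theorem IsDiag.unique {b : HilbertBasis ι ℝ H} {a : ι → ℝ} {A A' : H →L[ℝ] H}
    (h : IsDiag b a A) (h' : IsDiag b a A') : A = A' :=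
  ext_hilbertBasis b fun i => by rw [h i, h' i]

theorem IsDiag.hasSum_inner {b : HilbertBasis ι ℝ H} {a : ι → ℝ} {A : H →L[ℝ] H}
    (h : IsDiag b a A) (x : H) : HasSum (fun i => a i * ⟪b i, x⟫_ℝ ^ 2) ⟪x, A x⟫_ℝ := by
  have := b.hasSum_inner_mul_inner x (A x)
  have e : (fun i => a i * ⟪b i, x⟫_ℝ ^ 2) = fun i => ⟪x, b i⟫_ℝ * ⟪b i, A x⟫_ℝ := by
    funext i
    rw [h.inner_apply, real_inner_comm]
    ring
  rwa [e]

theorem IsDiag.le_inner {b : HilbertBasis ι ℝ H} {a : ι → ℝ} {A : H →L[ℝ] H}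
    (h : IsDiag b a A) {c : ℝ} (hc : ∀ i, c ≤ a i) (x : H) : c * ‖x‖ ^ 2 ≤ ⟪x, A x⟫_ℝ :=
  hasSum_le (fun i => mul_le_mul_of_nonneg_right (hc i) (sq_nonneg _))
    ((hasSum_sq_inner b x).mul_left c) (h.hasSum_inner x)

theorem IsDiag.norm_apply_le {b : HilbertBasis ι ℝ H} {u : ι → ℝ} {U : H →L[ℝ] H}
    (h : IsDiag b u U) (hu : ∀ i, 0 ≤ u i ∧ u i ≤ 1) (x : H) : ‖U x‖ ≤ ‖x‖ := by
  refine abs_le_of_sq_le_sq' ?_ (norm_nonneg x) |>.2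
  refine hasSum_le (fun i => ?_) (hasSum_sq_inner b (U x)) (hasSum_sq_inner b x)
  obtain ⟨h0, h1⟩ := hu i
  rw [h.inner_apply, mul_pow]
  exact mul_le_of_le_one_left (sq_nonneg _) (by nlinarith)

variable [CompleteSpace H]

theorem IsDiag.isSelfAdjoint {b : HilbertBasis ι ℝ H} {a : ι → ℝ} {A : H →L[ℝ] H}
    (h : IsDiag b a A) : IsSelfAdjoint A := by
  rw [ContinuousLinearMap.isSelfAdjoint_iff']
  refine ext_hilbertBasis b fun i => eq_of_forall_inner b fun j => ?_
  rw [ContinuousLinearMap.adjoint_inner_right, h j, h i, inner_smul_left, inner_smul_right]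
  classical
  rw [inner_basis]
  split_ifs with h
  · rw [h]; simp
  · simp

theorem IsDiag.isPositive {b : HilbertBasis ι ℝ H} {a : ι → ℝ} {A : H →L[ℝ] H}
    (h : IsDiag b a A) (ha : ∀ i, 0 ≤ a i) : A.IsPositive := by
  rw [ContinuousLinearMap.isPositive_def']
  refine ⟨h.isSelfAdjoint, fun x => ?_⟩
  have := h.le_inner ha x
  rw [ContinuousLinearMap.reApplyInnerSelf_apply, RCLike.re_to_real, real_inner_comm]
  linarith

theorem exists_hilbertBasis_of_orthogonalFamily {H : Type u} {α : Type} [NormedAddCommGroup H]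
    [InnerProductSpace ℝ H] [CompleteSpace H] (E : α → Submodule ℝ H) [∀ μ, CompleteSpace (E μ)]
    (hE : OrthogonalFamily ℝ (fun μ => E μ) fun μ => (E μ).subtypeₗᵢ) (hbot : (⨆ μ, E μ)ᗮ = ⊥) :
    ∃ (κ : Type u) (b : HilbertBasis κ ℝ H) (f : κ → α), ∀ p, b p ∈ E (f p) := by
  let v : (Σ μ : α, onbIndex (E μ)) → H := fun p => (E p.1).subtypeₗᵢ (onb (E p.1) p.2)
  have hv : Orthonormal ℝ v :=
    hE.orthonormal_sigma_orthonormal (v_family := fun μ => (onb (E μ)))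
      fun μ => (onb (E μ)).orthonormal
  have hsp : (Submodule.span ℝ (Set.range v))ᗮ = ⊥ := by
    rw [Submodule.eq_bot_iff]
    intro x hx
    have hx' : ∀ p, ⟪v p, x⟫_ℝ = 0 := fun p => hx _ (Submodule.subset_span ⟨p, rfl⟩)
    rw [Submodule.eq_bot_iff] at hbot
    refine hbot x ?_
    rw [Submodule.mem_orthogonal]
    intro u hu
    refine Submodule.iSup_induction E (motive := fun u => ⟪u, x⟫_ℝ = 0) hu ?_ ?_ ?_
    · intro μ y hy
      have h1 : (innerSL ℝ x) ∘L (E μ).subtypeL = 0 := by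
        refine ext_hilbertBasis (onb (E μ)) fun i => ?_
        have := hx' ⟨μ, i⟩
        rwa [real_inner_comm] at this
      rw [real_inner_comm]
      exact congrArg (fun T : E μ →L[ℝ] ℝ => T ⟨y, hy⟩) h1
    · simp
    · intro y z hy hz
      rw [inner_add_left, hy, hz, add_zero]
  refine ⟨_, HilbertBasis.mkOfOrthogonalEqBot hv hsp, fun p => p.1, fun p => ?_⟩
  rw [HilbertBasis.coe_mkOfOrthogonalEqBot]
  exact (onb (E p.1) p.2).2

theorem exists_isDiag_of_isCompactOperator {H : Type u} [NormedAddCommGroup H]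
    [InnerProductSpace ℝ H] [CompleteSpace H] {A : H →L[ℝ] H} (hc : IsCompactOperator A)
    (hA : IsSelfAdjoint A) :
    ∃ (κ : Type u) (b : HilbertBasis κ ℝ H) (a : κ → ℝ), IsDiag b a A := by
  have hsymm : (A : H →ₗ[ℝ] H).IsSymmetric := hA.isSymmetric
  have hcomp : ∀ μ, CompleteSpace (Module.End.eigenspace (A : Module.End ℝ H) μ) := fun μ => by
    refine IsClosed.completeSpace_coe (hs := ?_)
    have : (Module.End.eigenspace (A : Module.End ℝ H) μ : Set H) = {x | A x = μ • x} := by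
      ext x
      simp
    rw [this]
    exact isClosed_eq A.continuous (continuous_const_smul μ)
  obtain ⟨κ, b, f, hb⟩ := exists_hilbertBasis_of_orthogonalFamily _
    hsymm.orthogonalFamily_eigenspaces
    (ContinuousLinearMap.orthogonalComplement_iSup_eigenspaces_eq_bot hc hsymm)
  exact ⟨κ, b, f, fun i => Module.End.mem_eigenspace_iff.mp (hb i)⟩

theorem IsHilbertSchmidt.exists_isDiag {H : Type u} [NormedAddCommGroup H]
    [InnerProductSpace ℝ H] [CompleteSpace H] {A : H →L[ℝ] H} (hA : IsHilbertSchmidt A)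
    (hsa : IsSelfAdjoint A) :
    ∃ (κ : Type u) (b : HilbertBasis κ ℝ H) (a : κ → ℝ), IsDiag b a A :=
  exists_isDiag_of_isCompactOperator hA.isCompactOperator hsa

end Diagonal

/-! ### Square roots and trace class operators -/

section TraceClass

variable {H : Type*} [NormedAddCommGroup H] [InnerProductSpace ℝ H] {ι ι' : Type*}

/-- A positive operator with an eigenbasis is the only positive square root of its square: a positive
`A` with `A² = R²` has the eigenvectors of `R`, as `A + r` is injective for `r > 0`. -/
theorem IsDiag.eq_of_mul_self_eq {b : HilbertBasis ι ℝ H} {r : ι → ℝ} {R A : H →L[ℝ] H}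
    (hR : IsDiag b r R) (hr : ∀ i, 0 ≤ r i) (hA : A.IsPositive) (h : A * A = R * R) : A = R := by
  refine ext_hilbertBasis b fun i => ?_
  have h2 : A (A (b i)) = (r i * r i) • b i := by
    have := congrArg (fun T => T (b i)) h
    simpa [hR i, smul_smul] using this
  have hsa := hA.inner_left_eq_inner_right
  rcases (hr i).eq_or_lt with h0 | h0
  · have h3 : ⟪A (b i), A (b i)⟫_ℝ = 0 := by rw [hsa, h2, ← h0]; simp
    rw [hR i, ← h0, inner_self_eq_zero.mp h3, zero_smul]
  · set y := A (b i) - r i • b i with hy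
    have h3 : A y = -(r i • y) := by
      rw [hy, map_sub, map_smul, h2, smul_sub, smul_smul]
      abel
    have h4 := hA.inner_nonneg_right y
    rw [h3, inner_neg_right, inner_smul_right, real_inner_self_eq_norm_sq] at h4
    have h5 : ‖y‖ ^ 2 = 0 := by nlinarith [sq_nonneg ‖y‖]
    rw [hR i, ← sub_eq_zero, ← hy]
    simpa using h5

/-- Expand `⟪z, R z⟫ ≥ 0` at `z = (‖R‖ + 1) x - R x`. -/
theorem norm_sq_apply_le_of_isPositive {R : H →L[ℝ] H} (hR : R.IsPositive) (x : H) :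
    ‖R x‖ ^ 2 ≤ (‖R‖ + 1) * ⟪x, R x⟫_ℝ := by
  have hM : 0 < ‖R‖ + 1 := by positivity
  have h := hR.inner_nonneg_right ((‖R‖ + 1) • x - R x)
  have h1 : ⟪x, R (R x)⟫_ℝ = ‖R x‖ ^ 2 := by
    rw [← hR.inner_left_eq_inner_right, real_inner_self_eq_norm_sq]
  have h2 : ⟪R x, R (R x)⟫_ℝ ≤ ‖R‖ * ‖R x‖ ^ 2 := by
    refine (real_inner_le_norm _ _).trans ?_
    nlinarith [R.le_opNorm (R x), norm_nonneg (R x)]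
  rw [map_sub, map_smul, inner_sub_left, inner_sub_right, inner_sub_right, inner_smul_left,
    inner_smul_left, inner_smul_right, inner_smul_right, real_inner_self_eq_norm_sq, h1] at h
  simp only [conj_trivial] at h
  have h3 : (‖R‖ + 1) * ‖R x‖ ^ 2 ≤ (‖R‖ + 1) * ((‖R‖ + 1) * ⟪x, R x⟫_ℝ) := by
    nlinarith [sq_nonneg ‖R x‖]
  exact le_of_mul_le_mul_left h3 hM

theorem opSqrt_spec {A : H →L[ℝ] H} (h : ∃ R : H →L[ℝ] H, R.IsPositive ∧ R * R = A) :
    (opSqrt A).IsPositive ∧ opSqrt A * opSqrt A = A := by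
  rw [opSqrt, dif_pos h]
  exact h.choose_spec

theorem exists_sqrt {b : HilbertBasis ι ℝ H} {a : ι → ℝ} {A : H →L[ℝ] H}
    (hA : IsDiag b a A) (ha : ∀ i, 0 ≤ a i) :
    ∃ R : H →L[ℝ] H, IsDiag b (fun i => √(a i)) R ∧ R * R = A := by
  obtain ⟨R, hR⟩ := GeoJS.exists_isDiag b (a := fun i => √(a i)) (M := √‖A‖) fun i => by
    rw [abs_of_nonneg (Real.sqrt_nonneg _)]
    exact Real.sqrt_le_sqrt ((le_abs_self _).trans (hA.abs_le i))
  refine ⟨R, hR, (hR.mul hR).unique ?_⟩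
  simpa only [Real.mul_self_sqrt (ha _)] using hA

theorem IsDiag.summable_inner {b : HilbertBasis ι ℝ H} {r : ι → ℝ} {R : H →L[ℝ] H}
    (hR : IsDiag b r R) (hr : ∀ i, 0 ≤ r i) (hs : Summable r) (b' : HilbertBasis ι' ℝ H) :
    Summable fun j => ⟪b' j, R (b' j)⟫_ℝ := by
  have h0 : (0 : ι × ι' → ℝ) ≤ fun p => r p.1 * ⟪b p.1, b' p.2⟫_ℝ ^ 2 :=
    fun p => mul_nonneg (hr _) (sq_nonneg _)
  have hsum : ∀ i, HasSum (fun j => r i * ⟪b i, b' j⟫_ℝ ^ 2) (r i) := fun i => by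
    have := (hasSum_sq_inner b' (b i)).mul_left (r i)
    rw [norm_basis, one_pow, mul_one] at this
    simpa only [real_inner_comm] using this
  have h1 : Summable fun p : ι × ι' => r p.1 * ⟪b p.1, b' p.2⟫_ℝ ^ 2 :=
    (summable_prod_of_nonneg h0).mpr
      ⟨fun i => (hsum i).summable, hs.congr fun i => (hsum i).tsum_eq.symm⟩
  have h2 := ((Equiv.prodComm ι' ι).hasSum_iff.mpr h1.hasSum).prod_fiberwise
    fun j => hR.hasSum_inner (b' j)
  exact h2.summable

variable [CompleteSpace H]

theorem opSqrt_eq {b : HilbertBasis ι ℝ H} {r : ι → ℝ} {R A : H →L[ℝ] H}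
    (hR : IsDiag b r R) (hr : ∀ i, 0 ≤ r i) (h : R * R = A) : opSqrt A = R := by
  have hex : ∃ R : H →L[ℝ] H, R.IsPositive ∧ R * R = A := ⟨R, hR.isPositive hr, h⟩
  rw [opSqrt, dif_pos hex]
  exact hR.eq_of_mul_self_eq hr hex.choose_spec.1 (hex.choose_spec.2.trans h.symm)

theorem adjoint_mul_self_inner (A : H →L[ℝ] H) (x : H) :
    ⟪x, (ContinuousLinearMap.adjoint A * A) x⟫_ℝ = ‖A x‖ ^ 2 := by
  rw [mul_apply_eq_comp, ContinuousLinearMap.adjoint_inner_right, real_inner_self_eq_norm_sq]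

theorem isSelfAdjoint_adjoint_mul_self (A : H →L[ℝ] H) :
    IsSelfAdjoint (ContinuousLinearMap.adjoint A * A) := by
  rw [← ContinuousLinearMap.star_eq_adjoint]; exact IsSelfAdjoint.star_mul_self A

/-- A product of two Hilbert-Schmidt operators is trace class: if `|A| f = s f` with `s ≠ 0`, then
`A f = s g` for an orthonormal system of vectors `g`, and `s = ⟪X* g, Y f⟫` when `A = X Y`. -/
theorem IsHilbertSchmidt.isTraceClass_mul {X Y : H →L[ℝ] H} (hX : IsHilbertSchmidt X)
    (hY : IsHilbertSchmidt Y) : IsTraceClass (X * Y) := by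
  set A := X * Y with hAdef
  have hA : IsHilbertSchmidt A := hY.mul_left X
  obtain ⟨κ, f, a, hf⟩ := (hA.mul_left (ContinuousLinearMap.adjoint A)).exists_isDiag
    (isSelfAdjoint_adjoint_mul_self A)
  have ha : ∀ i, a i = ‖A (f i)‖ ^ 2 := fun i => by
    rw [hf.eigenvalue_eq, adjoint_mul_self_inner]
  have ha0 : ∀ i, 0 ≤ a i := fun i => ha i ▸ sq_nonneg _
  obtain ⟨R, hR, hRR⟩ := exists_sqrt hf ha0
  have habs : opAbs A = R := opSqrt_eq hR (fun i => Real.sqrt_nonneg _) hRR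
  have hsq : (fun i => √(a i)) = fun i => ‖A (f i)‖ := by
    funext i
    rw [ha, Real.sqrt_sq (norm_nonneg _)]
  rw [hsq] at hR
  unfold IsTraceClass
  rw [habs]
  refine hR.summable_inner (fun i => norm_nonneg _) ?_ (onb H)
  let J := {i // A (f i) ≠ 0}
  let g : J → H := fun j => ‖A (f j)‖⁻¹ • A (f j)
  have hg : Orthonormal ℝ g := by
    classical
    rw [orthonormal_iff_ite]
    intro i j
    have h1 : ⟪A (f i), A (f j)⟫_ℝ = a j * ⟪f i, f j⟫_ℝ := by
      rw [← ContinuousLinearMap.adjoint_inner_right, ← mul_apply_eq_comp, hf j,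
        inner_smul_right]
    simp only [g]
    rw [inner_smul_left, inner_smul_right, h1, inner_basis]
    by_cases hij : i = j
    · subst hij
      have hi : ‖A (f i)‖ ≠ 0 := norm_ne_zero_iff.mpr i.2
      simp only [if_true, ha]
      simp
      field_simp
    · have : (i : κ) ≠ j := fun h => hij (Subtype.ext h)
      simp [hij, this]
  obtain ⟨w, b, hw, hb⟩ := hg.toSubtypeRange.exists_hilbertBasis_extension
  let φ : J → w := fun j => ⟨g j, hw ⟨j, rfl⟩⟩
  have hφ : Function.Injective φ := fun i j h => hg.linearIndependent.injective
    (congrArg Subtype.val h)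
  have h1 : Summable fun j : J => ‖ContinuousLinearMap.adjoint X (g j)‖ ^ 2 := by
    have := (hX.adjoint.hasSum b).summable.comp_injective hφ
    simpa only [Function.comp_def, hb] using this
  have h2 : Summable fun j : J => ‖Y (f j)‖ ^ 2 :=
    (hY.hasSum f).summable.comp_injective Subtype.val_injective
  have h3 : Summable ((fun i => ‖A (f i)‖) ∘ (Subtype.val : J → κ)) := by
    refine Summable.of_nonneg_of_le (fun _ => norm_nonneg _) (fun j => ?_) (h1.add h2)
    have hj : ‖A (f j)‖ ≠ 0 := norm_ne_zero_iff.mpr j.2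
    have h4 : ‖A (f j)‖ = ⟪ContinuousLinearMap.adjoint X (g j), Y (f j)⟫_ℝ := by
      rw [ContinuousLinearMap.adjoint_inner_left, ← mul_apply_eq_comp, ← hAdef]
      simp only [g]
      rw [inner_smul_left, real_inner_self_eq_norm_sq]
      simp
      field_simp
    have h5 := real_inner_le_norm (ContinuousLinearMap.adjoint X (g j)) (Y (f j))
    simp only [Function.comp_apply]
    rw [h4]
    nlinarith [sq_nonneg (‖ContinuousLinearMap.adjoint X (g j)‖ - ‖Y (f j)‖),
      norm_nonneg (ContinuousLinearMap.adjoint X (g j)), norm_nonneg (Y (f j))]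
  refine (Subtype.val_injective.summable_iff fun i hi => ?_).mp h3
  by_contra hne
  exact hi ⟨⟨i, fun h => hne (by rw [h, norm_zero])⟩, rfl⟩

/-- The existence of `|A|` has to be assumed here: otherwise `opAbs A` is `0`. -/
theorem IsTraceClass.isHilbertSchmidt {A : H →L[ℝ] H}
    (h : ∃ R : H →L[ℝ] H, R.IsPositive ∧ R * R = ContinuousLinearMap.adjoint A * A)
    (hA : IsTraceClass A) : IsHilbertSchmidt A := by
  obtain ⟨h1, h2⟩ := opSqrt_spec h
  refine Summable.of_nonneg_of_le (fun _ => sq_nonneg _) (fun k => ?_)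
    (Summable.mul_left (‖opAbs A‖ + 1) hA)
  have h3 : ‖A (onb H k)‖ ^ 2 = ‖opAbs A (onb H k)‖ ^ 2 := by
    rw [← adjoint_mul_self_inner, ← h2, mul_apply_eq_comp, ← h1.inner_left_eq_inner_right,
      real_inner_self_eq_norm_sq]
    rfl
  rw [h3]
  exact norm_sq_apply_le_of_isPositive h1 _

theorem infinite_onbIndex (hdim : ¬ FiniteDimensional ℝ H) : Infinite (onbIndex H) := by
  by_contra hfin
  rw [not_infinite_iff_finite] at hfin
  have := Fintype.ofFinite (onbIndex H)
  exact hdim (onb H).toOrthonormalBasis.toBasis.finiteDimensional_of_finite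

/-- If `T - γ` is trace class for two values of `γ`, the identity is Hilbert-Schmidt. -/
theorem scalarPart_eq (hdim : ¬ FiniteDimensional ℝ H) {T : H →L[ℝ] H} {γ : ℝ}
    (hK : IsHilbertSchmidt (T - γ • 1)) (htr : IsTraceClass (T - γ • 1)) : scalarPart T = γ := by
  have hT : IsExtTraceClass T := ⟨γ, htr⟩
  rw [scalarPart, dif_pos hT]
  have hγ' := hT.choose_spec
  set γ' := hT.choose
  set K := T - γ • 1 with hKdef
  set A := T - γ' • 1 with hAdef
  have hAK : A = K + (γ - γ') • 1 := by rw [hAdef, hKdef, sub_smul]; abel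
  set δ := γ - γ' with hδ
  have hN : ContinuousLinearMap.adjoint A * A = (ContinuousLinearMap.adjoint K * K + δ • K
      + δ • ContinuousLinearMap.adjoint K) + (δ * δ) • 1 := by
    simp only [hAK, ← ContinuousLinearMap.star_eq_adjoint, star_add, star_smul, star_one,
      add_mul, mul_add, smul_mul_assoc, mul_smul_comm, one_mul, mul_one, smul_smul,
      star_trivial, smul_add]
    abel
  set N := ContinuousLinearMap.adjoint K * K + δ • K + δ • ContinuousLinearMap.adjoint K
  have hNHS : IsHilbertSchmidt N :=
    ((hK.mul_left _).add (hK.smul δ)).add (hK.adjoint.smul δ)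
  have hNsa : IsSelfAdjoint N := by
    have h1 : N = ContinuousLinearMap.adjoint A * A - (δ * δ) • 1 := by rw [hN]; abel
    rw [h1]
    exact (isSelfAdjoint_adjoint_mul_self A).sub ((IsSelfAdjoint.all (δ * δ)).smul
      (IsSelfAdjoint.one _))
  obtain ⟨κ, b, a, hb⟩ := hNHS.exists_isDiag hNsa
  have hAA : IsDiag b (fun i => a i + (δ * δ) * 1) (ContinuousLinearMap.adjoint A * A) := by
    rw [hN]
    exact hb.add ((isDiag_one b).smul _)
  obtain ⟨R, hR, hRR⟩ := exists_sqrt hAA fun i => by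
    rw [hAA.eigenvalue_eq, adjoint_mul_self_inner]
    positivity
  have hAHS : IsHilbertSchmidt A :=
    hγ'.isHilbertSchmidt ⟨R, hR.isPositive fun _ => Real.sqrt_nonneg _, hRR⟩
  have h1 : IsHilbertSchmidt (δ • (1 : H →L[ℝ] H)) := by
    have := hAHS.sub hK
    rwa [hAK, add_sub_cancel_left] at this
  have h2 : Summable fun _ : onbIndex H => δ ^ 2 := by
    refine Summable.congr h1 fun k => ?_
    simp [norm_smul, norm_basis]
  have := infinite_onbIndex hdim
  rw [summable_const_iff] at h2
  have : δ = 0 := by simpa using h2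
  linarith

/-- By uniqueness of positive square roots `|A| = A`, so that `∑ ‖√A e‖² = ∑ ⟪e, |A| e⟫ < ∞`. -/
theorem opSqrt_of_isTraceClass {A : H →L[ℝ] H} (hpos : A.IsPositive) (htr : IsTraceClass A) :
    (opSqrt A).IsPositive ∧ opSqrt A * opSqrt A = A ∧ IsHilbertSchmidt (opSqrt A) := by
  have hadj : ContinuousLinearMap.adjoint A = A := hpos.isSelfAdjoint.adjoint_eq
  have hHS : IsHilbertSchmidt A := htr.isHilbertSchmidt ⟨A, hpos, by rw [hadj]⟩
  obtain ⟨κ, b, a, hb⟩ := hHS.exists_isDiag hpos.isSelfAdjoint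
  have ha : ∀ i, 0 ≤ a i := fun i => by
    rw [hb.eigenvalue_eq]; exact hpos.inner_nonneg_right _
  have habs : opAbs A = A := opSqrt_eq hb ha (by rw [hadj])
  obtain ⟨R, hR, hRR⟩ := exists_sqrt hb ha
  obtain ⟨h1, h2⟩ := opSqrt_spec ⟨R, hR.isPositive fun _ => Real.sqrt_nonneg _, hRR⟩
  refine ⟨h1, h2, ?_⟩
  unfold IsTraceClass at htr
  rw [habs] at htr
  refine htr.congr fun k => ?_
  conv_lhs => rw [← h2]
  rw [mul_apply_eq_comp, ← h1.inner_left_eq_inner_right, real_inner_self_eq_norm_sq]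

end TraceClass

/-! ### Positive definite operators -/

section PosDef

variable {H : Type*} [NormedAddCommGroup H] [InnerProductSpace ℝ H] [CompleteSpace H]
  {ι ι' : Type*}

theorem PositiveDefinite.isUnit {P : H →L[ℝ] H} (hP : PositiveDefinite P) : IsUnit P := by
  obtain ⟨-, M, hM, h⟩ := hP
  refine P.isUnit_of_forall_le_norm_inner_map (c := ⟨M, hM.le⟩) hM fun x => ?_
  rw [real_inner_comm]
  have := h x
  rw [mul_comm] at this
  exact this.trans (le_abs_self _)

theorem PositiveDefinite.inverse {P : H →L[ℝ] H} (hP : PositiveDefinite P) :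
    PositiveDefinite (Ring.inverse P) := by
  have hu := hP.isUnit
  obtain ⟨hsa, M, hM, h⟩ := hP
  refine ⟨hsa.ringInverse, M / (‖P‖ ^ 2 + 1), by positivity, fun x => ?_⟩
  · set y := Ring.inverse P x with hy
    have hx : P y = x := by
      rw [hy, ← mul_apply_eq_comp, Ring.mul_inverse_cancel P hu]; rfl
    have h1 := h y
    rw [hx, real_inner_comm] at h1
    have h2 := P.le_opNorm y
    rw [hx] at h2
    have h3 : ‖x‖ ^ 2 ≤ (‖P‖ ^ 2 + 1) * ‖y‖ ^ 2 := by
      have : ‖x‖ ^ 2 ≤ (‖P‖ * ‖y‖) ^ 2 := pow_le_pow_left₀ (norm_nonneg _) h2 2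
      nlinarith [sq_nonneg ‖y‖]
    rw [div_mul_eq_mul_div, div_le_iff₀ (by positivity)]
    nlinarith

theorem PositiveDefinite.convex {P Q : H →L[ℝ] H} (hP : PositiveDefinite P)
    (hQ : PositiveDefinite Q) {α : ℝ} (hα : α ∈ Set.Icc (0 : ℝ) 1) :
    PositiveDefinite ((1 - α) • P + α • Q) := by
  obtain ⟨hP1, M, hM, hP2⟩ := hP
  obtain ⟨hQ1, N, hN, hQ2⟩ := hQ
  refine ⟨((IsSelfAdjoint.all (1 - α)).smul hP1).add ((IsSelfAdjoint.all α).smul hQ1),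
    min M N, lt_min hM hN, fun x => ?_⟩
  rw [add_apply, smul_apply, smul_apply, inner_add_right, inner_smul_right, inner_smul_right]
  have h1 : min M N * ‖x‖ ^ 2 ≤ ⟪x, P x⟫_ℝ :=
    (mul_le_mul_of_nonneg_right (min_le_left _ _) (sq_nonneg _)).trans (hP2 x)
  have h2 : min M N * ‖x‖ ^ 2 ≤ ⟪x, Q x⟫_ℝ :=
    (mul_le_mul_of_nonneg_right (min_le_right _ _) (sq_nonneg _)).trans (hQ2 x)
  nlinarith [mul_le_mul_of_nonneg_left h1 (sub_nonneg.mpr hα.2), mul_le_mul_of_nonneg_left h2 hα.1]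

theorem positiveDefinite_add_smul_one {A : H →L[ℝ] H} (hA : A.IsPositive) {γ : ℝ} (hγ : 0 < γ) :
    PositiveDefinite (A + γ • 1) := by
  refine ⟨hA.isSelfAdjoint.add ((IsSelfAdjoint.all γ).smul (IsSelfAdjoint.one _)), γ, hγ,
    fun x => ?_⟩
  rw [add_apply, smul_apply, one_apply_eq_self, inner_add_right, inner_smul_right,
    real_inner_self_eq_norm_sq]
  linarith [hA.inner_nonneg_right x]

theorem PositiveDefinite.strictlyPositive {P : H →L[ℝ] H} (hP : PositiveDefinite P) :
    StrictlyPositive P := by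
  obtain ⟨hsa, M, hM, h⟩ := hP
  refine ⟨hsa, fun x hx => lt_of_lt_of_le ?_ (h x)⟩
  have := norm_pos_iff.mpr hx
  positivity

theorem IsDiag.summable_sq {b : HilbertBasis ι ℝ H} {a : ι → ℝ} {A : H →L[ℝ] H}
    (h : IsDiag b a A) (hA : IsHilbertSchmidt A) : HasSum (fun i => a i ^ 2) (hsNormSq A) := by
  have e : (fun i => a i ^ 2) = fun i => ‖A (b i)‖ ^ 2 := by
    funext i
    rw [h i, norm_smul, norm_basis, mul_one, Real.norm_eq_abs, sq_abs]
  rw [e]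
  exact hA.hasSum b

/-- The eigenvalues of `1 - S` are positive and accumulate only at `1`. -/
theorem SymHSLtOne.positiveDefinite {S : H →L[ℝ] H} (hS : S ∈ SymHSLtOne H) :
    PositiveDefinite (1 - S) := by
  obtain ⟨hsa, hHS, hpos⟩ := hS
  refine ⟨hpos.1, ?_⟩
  obtain ⟨κ, b, s, hb⟩ := hHS.exists_isDiag hsa
  have hd : IsDiag b (fun i => 1 + -1 * s i) (1 - S) := by
    have := (isDiag_one b).add (hb.smul (-1))
    simpa [sub_eq_add_neg] using this
  have hd0 : ∀ i, 0 < 1 + -1 * s i := fun i => by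
    have := hpos.2 (b i) (basis_ne_zero b i)
    rwa [← hd.eigenvalue_eq] at this
  have hfin : {i | ¬ s i ^ 2 < 1 / 4}.Finite :=
    (hb.summable_sq hHS).summable.tendsto_cofinite_zero.eventually (gt_mem_nhds (by norm_num))
  have hc : ∃ c, 0 < c ∧ ∀ i ∈ hfin.toFinset, c ≤ 1 + -1 * s i := by
    rcases hfin.toFinset.eq_empty_or_nonempty with h | h
    · exact ⟨1, one_pos, fun i hi => absurd (h ▸ hi) (Finset.notMem_empty i)⟩
    · obtain ⟨i, -, hi⟩ := hfin.toFinset.exists_min_image (fun i => 1 + -1 * s i) h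
      exact ⟨_, hd0 i, hi⟩
  obtain ⟨c, hc0, hc⟩ := hc
  refine ⟨min c (1 / 2), lt_min hc0 (by norm_num), fun x => hd.le_inner (fun i => ?_) x⟩
  by_cases hi : s i ^ 2 < 1 / 4
  · refine (min_le_right _ _).trans ?_
    nlinarith
  · exact (min_le_left _ _).trans (hc i (by simpa using hi))

end PosDef

/-! ### Algebraic multiplicities -/

section AlgMult

variable {V : Type*} [AddCommGroup V] [Module ℝ V] {ι : Type*}

/-- A separating family of functionals `φ i` with dual vectors `v i` that diagonalizes `f`. An
operator that is similar to one with an orthonormal eigenbasis has such a family. -/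
structure IsBiorthDiag (f : V →ₗ[ℝ] V) (a : ι → ℝ) (v : ι → V) (φ : ι → V →ₗ[ℝ] ℝ) : Prop where
  map_vec : ∀ i, f (v i) = a i • v i
  map_fun : ∀ i x, φ i (f x) = a i * φ i x
  dual_self : ∀ i, φ i (v i) = 1
  dual_ne : ∀ i j, i ≠ j → φ i (v j) = 0
  sep : ∀ x, (∀ i, φ i x = 0) → x = 0

/-- Since `ℂ` is flat over `ℝ`, an element of `ker (M ⊗ ℂ)` comes from `ker M ⊗ ℂ`. -/
theorem ker_baseChange_mono {L M : V →ₗ[ℝ] V} (h : LinearMap.ker M ≤ LinearMap.ker L) :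
    LinearMap.ker (M.baseChange ℂ) ≤ LinearMap.ker (L.baseChange ℂ) := by
  intro m hm
  have hex := Module.Flat.lTensor_exact ℂ (LinearMap.exact_subtype_ker_map M)
  obtain ⟨y, rfl⟩ := (hex m).mp (by simpa [LinearMap.baseChange_eq_ltensor] using hm)
  have h0 : L ∘ₗ (LinearMap.ker M).subtype = 0 := by
    ext x
    exact h x.2
  rw [LinearMap.mem_ker, LinearMap.baseChange_eq_ltensor, ← LinearMap.lTensor_comp_apply, h0,
    LinearMap.lTensor_zero, LinearMap.zero_apply]

theorem finrank_ker_baseChange (L : V →ₗ[ℝ] V) :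
    Module.finrank ℂ (LinearMap.ker (L.baseChange ℂ)) = Module.finrank ℝ (LinearMap.ker L) := by
  have hinj : Function.Injective ((LinearMap.ker L).subtype.baseChange ℂ) := by
    rw [LinearMap.baseChange_eq_ltensor]
    exact Module.Flat.lTensor_preserves_injective_linearMap _ Subtype.val_injective
  have hex := Module.Flat.lTensor_exact ℂ (LinearMap.exact_subtype_ker_map L)
  have hr : LinearMap.range ((LinearMap.ker L).subtype.baseChange ℂ) =
      LinearMap.ker (L.baseChange ℂ) := by
    ext m
    rw [LinearMap.mem_range, LinearMap.mem_ker]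
    simp only [LinearMap.baseChange_eq_ltensor]
    exact (hex m).symm
  rw [← hr, ← (LinearEquiv.ofInjective _ hinj).finrank_eq, Module.finrank_baseChange]

variable {f : V →ₗ[ℝ] V} {a : ι → ℝ} {v : ι → V} {φ : ι → V →ₗ[ℝ] ℝ}

theorem IsBiorthDiag.ker_pow_le (h : IsBiorthDiag f a v φ) (t : ℝ) (k : ℕ) :
    LinearMap.ker ((f - t • (1 : Module.End ℝ V)) ^ k) ≤
      LinearMap.ker (f - t • (1 : Module.End ℝ V)) := by
  intro x hx
  rw [LinearMap.mem_ker] at hx ⊢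
  have h1 : ∀ i x, φ i ((f - t • (1 : Module.End ℝ V)) x) = (a i - t) * φ i x := fun i x => by
    rw [LinearMap.sub_apply, map_sub, h.map_fun, LinearMap.smul_apply, Module.End.one_apply,
      map_smul, smul_eq_mul]
    ring
  have h2 : ∀ i (k : ℕ), φ i (((f - t • (1 : Module.End ℝ V)) ^ k) x) = (a i - t) ^ k * φ i x :=
    fun i k => by
      induction k with
      | zero => simp
      | succ k ih => rw [pow_succ', Module.End.mul_apply, h1, ih]; ring
  refine h.sep _ fun i => ?_
  have h3 := h2 i k
  rw [hx, map_zero] at h3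
  rw [h1]
  rcases mul_eq_zero.mp h3.symm with h4 | h4
  · rw [eq_zero_of_pow_eq_zero h4, zero_mul]
  · rw [h4, mul_zero]

theorem baseChange_sub_smul_one (f : V →ₗ[ℝ] V) (t : ℝ) :
    (f - t • (1 : Module.End ℝ V)).baseChange ℂ =
      (f.baseChange ℂ : Module.End ℂ (ℂ ⊗[ℝ] V)) - (t : ℂ) • 1 := by
  rw [LinearMap.baseChange_sub, LinearMap.baseChange_smul, LinearMap.baseChange_one]
  exact congrArg _ (algebraMap_smul ℂ t (1 : Module.End ℂ (ℂ ⊗[ℝ] V))).symm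

theorem baseChange_sub_smul_one_pow (f : V →ₗ[ℝ] V) (t : ℝ) (k : ℕ) :
    ((f - t • (1 : Module.End ℝ V)) ^ k).baseChange ℂ =
      ((f.baseChange ℂ : Module.End ℂ (ℂ ⊗[ℝ] V)) - (t : ℂ) • 1) ^ k := by
  rw [LinearMap.baseChange_pow, baseChange_sub_smul_one]

/-- Generalized eigenvectors of `f` at `t` are eigenvectors, and this passes to the base change. -/
theorem IsBiorthDiag.maxGenEigenspace_ofReal (h : IsBiorthDiag f a v φ) (t : ℝ) :
    Module.End.maxGenEigenspace (f.baseChange ℂ : Module.End ℂ (ℂ ⊗[ℝ] V)) (t : ℂ) =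
      LinearMap.ker ((f - t • (1 : Module.End ℝ V)).baseChange ℂ) := by
  ext m
  rw [Module.End.mem_maxGenEigenspace]
  constructor
  · rintro ⟨k, hk⟩
    rw [← baseChange_sub_smul_one_pow] at hk
    exact ker_baseChange_mono (h.ker_pow_le t k) hk
  · intro hm
    refine ⟨1, ?_⟩
    rw [← baseChange_sub_smul_one_pow, pow_one]
    exact hm

theorem IsBiorthDiag.finrank_ker (h : IsBiorthDiag f a v φ) (t : ℝ) [Fintype {i // a i = t}] :
    Module.finrank ℝ (LinearMap.ker (f - t • (1 : Module.End ℝ V))) =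
      Fintype.card {i // a i = t} := by
  classical
  let Φ : LinearMap.ker (f - t • (1 : Module.End ℝ V)) →ₗ[ℝ] ({i // a i = t} → ℝ) :=
    LinearMap.pi fun i => φ i ∘ₗ Submodule.subtype _
  have hmem : ∀ x, x ∈ LinearMap.ker (f - t • (1 : Module.End ℝ V)) ↔ f x = t • x := fun x => by
    rw [LinearMap.mem_ker, LinearMap.sub_apply, sub_eq_zero]; rfl
  have hΦ : Function.Bijective Φ := by
    constructor
    · rw [← LinearMap.ker_eq_bot, LinearMap.ker_eq_bot']
      rintro ⟨x, hx⟩ hx0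
      have hx1 := (hmem x).mp hx
      refine Subtype.ext (h.sep x fun i => ?_)
      by_cases hi : a i = t
      · exact congrFun hx0 ⟨i, hi⟩
      · have h1 := h.map_fun i x
        rw [hx1, map_smul, smul_eq_mul] at h1
        have h2 : (a i - t) * φ i x = 0 := by rw [sub_mul, h1, sub_self]
        exact (mul_eq_zero.mp h2).resolve_left (sub_ne_zero.mpr hi)
    · intro c
      refine ⟨⟨∑ j, c j • v j, (hmem _).mpr ?_⟩, ?_⟩
      · rw [map_sum, Finset.smul_sum]
        refine Finset.sum_congr rfl fun j _ => ?_
        rw [map_smul, h.map_vec, j.2, smul_comm]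
      · funext i
        change φ i (∑ j, c j • v j) = c i
        rw [map_sum, Finset.sum_eq_single i]
        · rw [map_smul, h.dual_self, smul_eq_mul, mul_one]
        · intro j _ hj
          rw [map_smul, h.dual_ne i j (fun e => hj (Subtype.ext e.symm)), smul_zero]
        · simp
  rw [(LinearEquiv.ofBijective Φ hΦ).finrank_eq, Module.finrank_fintype_fun_eq_card]

/-- `(T - z̄) (T - z)` is the base change of `(f - re z)² + (im z)²`, which is injective. -/
theorem IsBiorthDiag.maxGenEigenspace_of_im_ne_zero (h : IsBiorthDiag f a v φ) {z : ℂ}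
    (hz : z.im ≠ 0) :
    Module.End.maxGenEigenspace (f.baseChange ℂ : Module.End ℂ (ℂ ⊗[ℝ] V)) z = ⊥ := by
  set T : Module.End ℂ (ℂ ⊗[ℝ] V) := f.baseChange ℂ with hT
  let L : Module.End ℝ V := (f - z.re • (1 : Module.End ℝ V)) ^ 2 + (z.im ^ 2) • 1
  have hL : Function.Injective L := by
    rw [← LinearMap.ker_eq_bot, LinearMap.ker_eq_bot']
    intro x hx
    refine h.sep x fun i => ?_
    have h1 : φ i (L x) = ((a i - z.re) ^ 2 + z.im ^ 2) * φ i x := by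
      simp only [L, sq, LinearMap.add_apply, Module.End.mul_apply, LinearMap.sub_apply,
        LinearMap.smul_apply, Module.End.one_apply, map_add, map_sub, map_smul, h.map_fun,
        smul_eq_mul]
      ring
    rw [hx, map_zero] at h1
    have h2 : 0 < (a i - z.re) ^ 2 + z.im ^ 2 := by positivity
    exact (mul_eq_zero.mp h1.symm).resolve_left h2.ne'
  have hLc : Function.Injective (L.baseChange ℂ) := by
    rw [LinearMap.baseChange_eq_ltensor]
    exact Module.Flat.lTensor_preserves_injective_linearMap _ hL
  have hfac : L.baseChange ℂ = (T - (starRingEnd ℂ z) • (1 : Module.End ℂ (ℂ ⊗[ℝ] V))) *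
      (T - z • (1 : Module.End ℂ (ℂ ⊗[ℝ] V))) := by
    have hneg : ∀ (c : ℂ) (X : Module.End ℂ (ℂ ⊗[ℝ] V)), (-c) • X = -(c • X) :=
      fun c X => neg_smul c X
    have e1 : T - z • (1 : Module.End ℂ (ℂ ⊗[ℝ] V)) =
        (T - (z.re : ℂ) • 1) - (z.im * Complex.I : ℂ) • 1 := by
      rw [sub_sub, ← add_smul, Complex.re_add_im]
    have e2 : T - (starRingEnd ℂ z) • (1 : Module.End ℂ (ℂ ⊗[ℝ] V)) =
        (T - (z.re : ℂ) • 1) + (z.im * Complex.I : ℂ) • 1 := by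
      have e0 : starRingEnd ℂ z = z.re + -(z.im * Complex.I) := by apply Complex.ext <;> simp
      rw [e0, add_smul, hneg]
      abel
    have e3 : (z.im * Complex.I : ℂ) * (z.im * Complex.I) = -((z.im ^ 2 : ℝ) : ℂ) := by
      push_cast
      linear_combination (z.im : ℂ) ^ 2 * Complex.I_mul_I
    have e4 : ((z.im ^ 2) • (1 : Module.End ℝ V)).baseChange ℂ =
        ((z.im ^ 2 : ℝ) : ℂ) • (1 : Module.End ℂ (ℂ ⊗[ℝ] V)) := by
      rw [LinearMap.baseChange_smul, LinearMap.baseChange_one]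
      exact (algebraMap_smul ℂ _ (1 : Module.End ℂ (ℂ ⊗[ℝ] V))).symm
    simp only [L]
    rw [LinearMap.baseChange_add, baseChange_sub_smul_one_pow, e4, e1, e2]
    rw [← hT]
    generalize T - (z.re : ℂ) • (1 : Module.End ℂ (ℂ ⊗[ℝ] V)) = P
    rw [add_mul, mul_sub, mul_sub, smul_mul_smul_comm, e3, mul_smul_comm, smul_mul_assoc, one_mul,
      mul_one, hneg, mul_one]
    rw [sq]
    abel
  have hinj : Function.Injective (T - z • (1 : Module.End ℂ (ℂ ⊗[ℝ] V))) := by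
    rw [hfac] at hLc
    exact Function.Injective.of_comp (f := (T - (starRingEnd ℂ z) • 1 : Module.End ℂ (ℂ ⊗[ℝ] V))) hLc
  rw [Submodule.eq_bot_iff]
  intro m hm
  obtain ⟨k, hk⟩ := (Module.End.mem_maxGenEigenspace _ _ _).mp hm
  have : Function.Injective ((T - z • (1 : Module.End ℂ (ℂ ⊗[ℝ] V))) ^ k) := by
    rw [Module.End.coe_pow]
    exact hinj.iterate k
  exact this (by rw [hk, map_zero])

end AlgMult

/-! ### Fredholm and Hilbert-Carleman determinants -/

section Determinant

variable {H : Type*} [NormedAddCommGroup H] [InnerProductSpace ℝ H] {ι ι' : Type*}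

theorem IsDiag.isBiorthDiag_conj {b : HilbertBasis ι ℝ H} {a : ι → ℝ} {A : H →L[ℝ] H}
    (h : IsDiag b a A) (J : (H →L[ℝ] H)ˣ) :
    IsBiorthDiag ((J * A * (J⁻¹ : (H →L[ℝ] H)ˣ) : H →L[ℝ] H) : H →ₗ[ℝ] H) a (fun i => J.1 (b i))
      (fun i => ((innerSL ℝ (b i)) ∘L (J⁻¹ : (H →L[ℝ] H)ˣ).1 : H →L[ℝ] ℝ)) := by
  have h1 : ∀ x, (J⁻¹ : (H →L[ℝ] H)ˣ).1 (J.1 x) = x := fun x => by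
    rw [← mul_apply_eq_comp, J.inv_mul]; rfl
  have h2 : ∀ x, J.1 ((J⁻¹ : (H →L[ℝ] H)ˣ).1 x) = x := fun x => by
    rw [← mul_apply_eq_comp, J.mul_inv]; rfl
  classical
  constructor
  · intro i
    simp [h1, h i]
  · intro i x
    simp [h1, h.inner_apply]
  · intro i
    simp [h1, norm_basis]
  · intro i j hij
    simp [h1, inner_basis, hij]
  · intro x hx
    have h3 : (J⁻¹ : (H →L[ℝ] H)ˣ).1 x = 0 := eq_of_forall_inner b fun i => by
      simpa using hx i
    rw [← h2 x, h3, map_zero]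

/-- For an operator similar to a diagonal one, the product over the eigenvalues is regrouped from the
product over the basis vectors. -/
theorem fredholmDet_conj {b : HilbertBasis ι ℝ H} {a : ι → ℝ} {A : H →L[ℝ] H}
    (h : IsDiag b a A) (J : (H →L[ℝ] H)ˣ) (ha : ∀ i, 0 < 1 + a i) {s : ℝ}
    (hs : HasSum (fun i => Real.log (1 + a i)) s) :
    fredholmDet (1 + (J * A * (J⁻¹ : (H →L[ℝ] H)ˣ) : H →L[ℝ] H)) = Real.exp s := by
  classical
  have hbi := h.isBiorthDiag_conj J
  set B : H →L[ℝ] H := J * A * (J⁻¹ : (H →L[ℝ] H)ˣ)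
  have hprod : HasProd (fun i => (1 + (a i : ℂ))) (Real.exp s : ℂ) := by
    have h1 := hs.rexp
    have h2 := h1.map Complex.ofRealHom.toMonoidHom Complex.continuous_ofReal
    have e : (fun i => (1 + (a i : ℂ))) =
        (Complex.ofRealHom.toMonoidHom : ℝ → ℂ) ∘ Real.exp ∘ fun i => Real.log (1 + a i) := by
      funext i
      simp [Real.exp_log (ha i)]
    rw [e]
    exact h2
  have hfin : ∀ t : ℝ, t ≠ 0 → Finite {i // a i = t} := fun t ht => by
    rcases isEmpty_or_nonempty {i // a i = t} with he | ⟨⟨i₀, hi₀⟩⟩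
    · infer_instance
    · have ht1 : 0 < 1 + t := hi₀ ▸ ha i₀
      have hlog : 0 < |Real.log (1 + t)| := by
        refine abs_pos.mpr (Real.log_ne_zero_of_pos_of_ne_one ht1 ?_)
        simpa using ht
      have h1 := hs.summable.tendsto_cofinite_zero.abs
      rw [abs_zero] at h1
      have h2 := h1.eventually (gt_mem_nhds hlog)
      refine Set.Finite.subset h2 fun i (hi : a i = t) => ?_
      simp [hi]
  have key : HasProd (fun z : ℂ => (1 + z) ^ algMult B z) (Real.exp s : ℂ) := by
    refine HasProd.sigma (γ := fun z : ℂ => {i // (a i : ℂ) = z})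
      ((Equiv.sigmaFiberEquiv fun i => (a i : ℂ)).hasProd_iff.mpr hprod) fun z => ?_
    change HasProd (fun c : {i // (a i : ℂ) = z} => 1 + (a c : ℂ)) _
    have e : (fun c : {i // (a i : ℂ) = z} => 1 + (a c : ℂ)) = fun _ => 1 + z := by
      funext c
      rw [c.2]
    rw [e]
    by_cases hz : z.im = 0
    · obtain ⟨t, rfl⟩ : ∃ t : ℝ, z = t := ⟨z.re, Complex.ext rfl (by simpa using hz)⟩
      by_cases ht : t = 0
      · subst ht
        simp
      · have := hfin t ht
        have := Fintype.ofFinite {i // a i = t}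
        let e : {i // (a i : ℂ) = t} ≃ {i // a i = t} :=
          Equiv.subtypeEquivRight fun i => Complex.ofReal_inj
        have := Fintype.ofEquiv _ e.symm
        have hm : algMult B t = Fintype.card {i // (a i : ℂ) = t} := by
          rw [algMult, hbi.maxGenEigenspace_ofReal, finrank_ker_baseChange, hbi.finrank_ker]
          exact Fintype.card_congr e.symm
        rw [hm]
        have := hasProd_fintype (fun _ : {i // (a i : ℂ) = t} => 1 + (t : ℂ))
        simpa using this
    · have hm : algMult B z = 0 := by
        rw [algMult, hbi.maxGenEigenspace_of_im_ne_zero hz, finrank_bot]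
      have : IsEmpty {i // (a i : ℂ) = z} := ⟨fun c => hz (by rw [← c.2, Complex.ofReal_im])⟩
      rw [hm, pow_zero]
      exact hasProd_empty
  rw [fredholmDet, add_sub_cancel_left, key.tprod_eq, Complex.ofReal_re]

variable [CompleteSpace H]

theorem IsDiag.exp {b : HilbertBasis ι ℝ H} {a : ι → ℝ} {A : H →L[ℝ] H} (h : IsDiag b a A) :
    IsDiag b (fun i => Real.exp (a i)) (NormedSpace.exp A) := by
  intro i
  have h1 := (NormedSpace.exp_series_hasSum_exp' (𝕂 := ℝ) A).mapL
    (ContinuousLinearMap.apply ℝ H (b i))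
  have h2 := (NormedSpace.exp_series_hasSum_exp' (𝕂 := ℝ) (a i)).mapL
    ((1 : ℝ →L[ℝ] ℝ).smulRight (b i))
  have h3 : ∀ n : ℕ, (A ^ n) (b i) = a i ^ n • b i := fun n => by
    induction n with
    | zero => simp
    | succ n ih => rw [pow_succ', mul_apply_eq_comp, ih, map_smul, h i, smul_smul, ← pow_succ]
  rw [Real.exp_eq_exp_ℝ]
  refine h1.unique ?_
  have e : (fun n : ℕ => ContinuousLinearMap.apply ℝ H (b i) ((n.factorial : ℝ)⁻¹ • A ^ n)) =
      fun n : ℕ => ((1 : ℝ →L[ℝ] ℝ).smulRight (b i)) ((n.factorial : ℝ)⁻¹ • a i ^ n) := by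
    funext n
    simp [h3, smul_smul]
  rw [e]
  simpa using h2

/-- `-log det₂(1 + A) = ∑ (aᵢ - log (1 + aᵢ))`. -/
theorem det2_conj {b : HilbertBasis ι ℝ H} {a : ι → ℝ} {A : H →L[ℝ] H}
    (h : IsDiag b a A) (J : (H →L[ℝ] H)ˣ) (ha : ∀ i, 0 < 1 + a i) {s : ℝ}
    (hs : HasSum (fun i => a i - Real.log (1 + a i)) s) :
    det2 (1 + (J * A * (J⁻¹ : (H →L[ℝ] H)ˣ) : H →L[ℝ] H)) = Real.exp (-s) := by
  have h1 : IsDiag b (fun i => (1 + a i) * Real.exp (-a i) + -1)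
      ((1 + A) * NormedSpace.exp (-A) + -1) :=
    (((isDiag_one b).add h).mul h.neg.exp).add (isDiag_one b).neg
  have h2 : ∀ i, 1 + ((1 + a i) * Real.exp (-a i) + -1) =
      (1 + a i) * Real.exp (-a i) := fun i => by ring
  have h3 := fredholmDet_conj h1 J (s := -s)
    (fun i => by rw [h2]; exact mul_pos (ha i) (Real.exp_pos _)) (by
      have e : (fun i => Real.log (1 + ((1 + a i) * Real.exp (-a i) + -1))) =
          fun i => -(a i - Real.log (1 + a i)) := by
        funext i
        rw [h2, Real.log_mul (ha i).ne' (Real.exp_pos _).ne', Real.log_exp]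
        ring
      rw [e]
      exact hs.neg)
  rw [det2, ← h3]
  congr 1
  rw [add_sub_cancel_left]
  have h4 : -(J * A * (J⁻¹ : (H →L[ℝ] H)ˣ) : H →L[ℝ] H) = J * (-A) * (J⁻¹ : (H →L[ℝ] H)ˣ) := by
    simp
  let _ : NormedAlgebra ℚ (H →L[ℝ] H) := NormedAlgebra.restrictScalars ℚ ℝ _
  rw [h4, NormedSpace.exp_units_conj]
  simp only [mul_add, add_mul, one_mul, J.mul_inv, mul_assoc, J.inv_mul_cancel_left, mul_neg,
    neg_mul]
  abel

end Determinant

/-! ### Continuity of the regularized log-determinant -/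

section Continuity

variable {H : Type*} [NormedAddCommGroup H] [InnerProductSpace ℝ H] {ι ι' : Type*}

theorem hasSum_mul_sq_inner (b : HilbertBasis ι ℝ H) (b' : HilbertBasis ι' ℝ H) {f : ι → ℝ} {s : ℝ}
    (hf : HasSum f s) : HasSum (fun p : ι × ι' => f p.1 * ⟪b p.1, b' p.2⟫_ℝ ^ 2) s := by
  have h1 : ∀ i (c : ℝ), HasSum (fun j => c * ⟪b i, b' j⟫_ℝ ^ 2) c := fun i c => by
    have := (hasSum_sq_inner b' (b i)).mul_left c
    rw [norm_basis, one_pow, mul_one] at this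
    simpa only [real_inner_comm] using this
  have h0 : (0 : ι × ι' → ℝ) ≤ fun p => |f p.1| * ⟪b p.1, b' p.2⟫_ℝ ^ 2 :=
    fun p => mul_nonneg (abs_nonneg _) (sq_nonneg _)
  have h2 : Summable fun p : ι × ι' => |f p.1| * ⟪b p.1, b' p.2⟫_ℝ ^ 2 :=
    (summable_prod_of_nonneg h0).mpr
      ⟨fun i => (h1 i |f i|).summable,
        hf.summable.abs.congr fun i => ((h1 i |f i|).tsum_eq).symm⟩
  have h3 : Summable fun p : ι × ι' => f p.1 * ⟪b p.1, b' p.2⟫_ℝ ^ 2 := by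
    refine Summable.of_norm_bounded h2 fun p => ?_
    rw [Real.norm_eq_abs, abs_mul, abs_of_nonneg (sq_nonneg ⟪b p.1, b' p.2⟫_ℝ)]
  have h4 : HasSum f _ := HasSum.prod_fiberwise h3.hasSum fun i => h1 i (f i)
  rw [hf.unique h4]
  exact h3.hasSum

variable [CompleteSpace H]

theorem abs_sub_log_sub_le {c x y : ℝ} (hc : 0 < c) (hx : c ≤ 1 + x) (hy : c ≤ 1 + y) :
    |(x - Real.log (1 + x)) - (y - Real.log (1 + y))| ≤ |x - y| * (|x| + |y|) / c := by
  have hx0 : 0 < 1 + x := hc.trans_le hx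
  have hy0 : 0 < 1 + y := hc.trans_le hy
  have h1 : Real.log (1 + x) - Real.log (1 + y) ≤ (1 + x) / (1 + y) - 1 := by
    rw [← Real.log_div hx0.ne' hy0.ne']
    exact Real.log_le_sub_one_of_pos (div_pos hx0 hy0)
  have h2 : Real.log (1 + y) - Real.log (1 + x) ≤ (1 + y) / (1 + x) - 1 := by
    rw [← Real.log_div hy0.ne' hx0.ne']
    exact Real.log_le_sub_one_of_pos (div_pos hy0 hx0)
  have e1 : (x - y) - ((1 + x) / (1 + y) - 1) = (x - y) * y / (1 + y) := by field_simp; ring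
  have e2 : (x - y) + ((1 + y) / (1 + x) - 1) = (x - y) * x / (1 + x) := by field_simp; ring
  have b1 : |(x - y) * y / (1 + y)| ≤ |x - y| * (|x| + |y|) / c := by
    rw [abs_div, abs_mul, abs_of_pos hy0]
    gcongr
    linarith [abs_nonneg x]
  have b2 : |(x - y) * x / (1 + x)| ≤ |x - y| * (|x| + |y|) / c := by
    rw [abs_div, abs_mul, abs_of_pos hx0]
    gcongr
    linarith [abs_nonneg y]
  rw [abs_le]
  constructor
  · linarith [neg_abs_le ((x - y) * y / (1 + y))]
  · linarith [le_abs_self ((x - y) * x / (1 + x))]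

theorem summable_sub_log {c : ℝ} (hc : 0 < c) {a : ι → ℝ} (ha : ∀ i, c ≤ 1 + a i)
    (hs : Summable fun i => a i ^ 2) : Summable fun i => a i - Real.log (1 + a i) := by
  rcases isEmpty_or_nonempty ι with he | ⟨⟨i₀⟩⟩
  · exact summable_empty
  refine Summable.of_norm_bounded ((hs.div_const (min c 1))) fun i => ?_
  have := abs_sub_log_sub_le (lt_min hc one_pos) ((min_le_left c 1).trans (ha i))
    (y := 0) ((min_le_right c 1).trans (by norm_num))
  simpa [← sq] using this

/-- In terms of eigenbases `b` of `Λ` and `b'` of `Λ'`, all three squared Hilbert-Schmidt norms and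
both traces are sums over pairs, with weights `⟪b i, b' j⟫²`. -/
theorem abs_sum_sub_log_sub_le {b : HilbertBasis ι ℝ H} {b' : HilbertBasis ι' ℝ H}
    {a : ι → ℝ} {a' : ι' → ℝ} {Λ Λ' : H →L[ℝ] H} (h : IsDiag b a Λ) (h' : IsDiag b' a' Λ')
    (hΛ : IsHilbertSchmidt Λ) (hΛ' : IsHilbertSchmidt Λ') {c : ℝ} (hc : 0 < c)
    (ha : ∀ i, c ≤ 1 + a i) (ha' : ∀ i, c ≤ 1 + a' i) {s s' : ℝ}
    (hs : HasSum (fun i => a i - Real.log (1 + a i)) s)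
    (hs' : HasSum (fun i => a' i - Real.log (1 + a' i)) s') {δ : ℝ} (hδ : 0 < δ) :
    |s - s'| ≤ (δ * (hsNormSq Λ + hsNormSq Λ') + δ⁻¹ * hsNormSq (Λ - Λ')) / c := by
  have hD : HasSum (fun p : ι × ι' => (a p.1 - a' p.2) ^ 2 * ⟪b p.1, b' p.2⟫_ℝ ^ 2)
      (hsNormSq (Λ - Λ')) := by
    have hΛd := hΛ.sub hΛ'
    have h1 := summable_matrix b' b (hΛd.hasSum b').summable
    have h2 := h1.hasSum.prod_fiberwise fun j => hasSum_sq_inner b ((Λ - Λ') (b' j))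
    have h3 := h1.hasSum
    rw [← (hΛd.hasSum b').unique h2] at h3
    have h4 := (Equiv.prodComm ι ι').hasSum_iff.mpr h3
    have e : (fun p : ι × ι' => (a p.1 - a' p.2) ^ 2 * ⟪b p.1, b' p.2⟫_ℝ ^ 2) =
        (fun p : ι' × ι => ⟪b p.2, (Λ - Λ') (b' p.1)⟫_ℝ ^ 2) ∘ Equiv.prodComm ι ι' := by
      funext p
      simp only [Function.comp, Equiv.prodComm_apply, Prod.fst_swap, Prod.snd_swap]
      rw [sub_apply, inner_sub_right, h.inner_apply, h' p.2, inner_smul_right]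
      ring
    rw [e]
    exact h4
  have hswap : ∀ {f : ι' → ℝ} {t : ℝ}, HasSum f t →
      HasSum (fun p : ι × ι' => f p.2 * ⟪b p.1, b' p.2⟫_ℝ ^ 2) t := fun hf => by
    have := (Equiv.prodComm ι ι').hasSum_iff.mpr (hasSum_mul_sq_inner b' b hf)
    simpa only [Function.comp_def, Equiv.prodComm_apply, Prod.fst_swap, Prod.snd_swap,
      real_inner_comm] using this
  have h1 := (hasSum_mul_sq_inner b b' hs).sub (hswap hs')
  have h2 := ((((hasSum_mul_sq_inner b b' (h.summable_sq hΛ)).add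
    (hswap (h'.summable_sq hΛ'))).mul_left δ).add (hD.mul_left δ⁻¹)).div_const c
  have hpt : ∀ x y w : ℝ, c ≤ 1 + x → c ≤ 1 + y → 0 ≤ w →
      |(x - Real.log (1 + x)) * w - (y - Real.log (1 + y)) * w| ≤
        (δ * (x ^ 2 * w + y ^ 2 * w) + δ⁻¹ * ((x - y) ^ 2 * w)) / c := fun x y w hx hy hw => by
    rw [← sub_mul, abs_mul, abs_of_nonneg hw]
    refine (mul_le_mul_of_nonneg_right (abs_sub_log_sub_le hc hx hy) hw).trans ?_
    rw [div_mul_eq_mul_div]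
    refine div_le_div_of_nonneg_right ?_ hc.le
    have e : δ * (x ^ 2 * w + y ^ 2 * w) + δ⁻¹ * ((x - y) ^ 2 * w) =
        (δ * (x ^ 2 + y ^ 2) + δ⁻¹ * (x - y) ^ 2) * w := by ring
    rw [e]
    refine mul_le_mul_of_nonneg_right ?_ hw
    -- `t u ≤ δ u² / 2 + δ⁻¹ t² / 2` for `t = |x - y|` and `u = |x| + |y|`.
    have h3 : 0 ≤ δ⁻¹ * (|x - y| - δ * (|x| + |y|)) ^ 2 := by positivity
    have e3 : δ⁻¹ * (|x - y| - δ * (|x| + |y|)) ^ 2 =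
        δ⁻¹ * |x - y| ^ 2 - 2 * (|x - y| * (|x| + |y|)) + δ * (|x| + |y|) ^ 2 := by
      field_simp
      ring
    rw [e3, sq_abs] at h3
    have h4 : (|x| + |y|) ^ 2 ≤ 2 * (x ^ 2 + y ^ 2) := by
      nlinarith [sq_nonneg (|x| - |y|), sq_abs x, sq_abs y]
    have h5 := mul_le_mul_of_nonneg_left h4 hδ.le
    have h6 : 0 ≤ δ⁻¹ * (x - y) ^ 2 := by positivity
    linarith
  have hpt' : ∀ p : ι × ι', _ := fun p =>
    abs_le.mp (hpt (a p.1) (a' p.2) _ (ha _) (ha' _) (sq_nonneg ⟪b p.1, b' p.2⟫_ℝ))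
  exact abs_le.mpr ⟨hasSum_le (fun p => (hpt' p).1) h2.neg h1, hasSum_le (fun p => (hpt' p).2) h1 h2⟩

theorem hsNormSq_le (A B : H →L[ℝ] H) (hA : IsHilbertSchmidt A) (hB : IsHilbertSchmidt B) :
    hsNormSq A ≤ 2 * hsNormSq (A - B) + 2 * hsNormSq B := by
  refine hasSum_le (fun k => ?_) (hA.hasSum (onb H))
    ((((hA.sub hB).hasSum (onb H)).mul_left 2).add ((hB.hasSum (onb H)).mul_left 2))
  rw [sub_apply]
  have h1 := norm_add_le (A (onb H k) - B (onb H k)) (B (onb H k))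
  rw [sub_add_cancel] at h1
  have h2 := norm_nonneg (A (onb H k))
  nlinarith [sq_nonneg (‖A (onb H k) - B (onb H k)‖ - ‖B (onb H k)‖)]

/-- Let `Λ γ → Λ₀` in Hilbert-Schmidt norm, with all eigenvalues of `1 + Λ γ` at least `c > 0`; then
the sums `∑ (aᵢ - log (1 + aᵢ))` over the eigenvalues converge. -/
theorem tendsto_sum_sub_log {l : Filter ℝ} {Λ : ℝ → H →L[ℝ] H} {Λ₀ : H →L[ℝ] H}
    {c : ℝ} (hc : 0 < c) {F : ℝ → ℝ} {s : ℝ} {κ₀ : Type*} {b₀ : HilbertBasis κ₀ ℝ H} {a₀ : κ₀ → ℝ}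
    (hΛ₀ : IsHilbertSchmidt Λ₀) (hd₀ : IsDiag b₀ a₀ Λ₀) (ha₀ : ∀ i, c ≤ 1 + a₀ i)
    (hs : HasSum (fun i => a₀ i - Real.log (1 + a₀ i)) s)
    (hF : ∀ᶠ γ in l, IsHilbertSchmidt (Λ γ) ∧ ∃ (κ : Type u) (b : HilbertBasis κ ℝ H) (a : κ → ℝ),
      IsDiag b a (Λ γ) ∧ (∀ i, c ≤ 1 + a i) ∧
        HasSum (fun i => a i - Real.log (1 + a i)) (F γ))
    (hlim : Tendsto (fun γ => hsNormSq (Λ γ - Λ₀)) l (𝓝 0)) : Tendsto F l (𝓝 s) := by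
  rw [Metric.tendsto_nhds]
  intro ε hε
  have hN := hsNormSq_nonneg Λ₀
  set δ := c * ε / (2 * (3 * hsNormSq Λ₀ + 2)) with hδdef
  have hδ : 0 < δ := by positivity
  have hδ2 : δ * (3 * hsNormSq Λ₀ + 2) = c * ε / 2 := by
    rw [hδdef]
    field_simp
  have h1 : ∀ᶠ γ in l, hsNormSq (Λ γ - Λ₀) < 1 := hlim.eventually (gt_mem_nhds one_pos)
  have h2 : ∀ᶠ γ in l, hsNormSq (Λ γ - Λ₀) < δ * (c * ε / 2) :=
    hlim.eventually (gt_mem_nhds (by positivity))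
  filter_upwards [h1, h2, hF] with γ h1 h2 ⟨hHS, κ, b, a, hd, ha, hsum⟩
  have h3 := abs_sum_sub_log_sub_le hd hd₀ hHS hΛ₀ hc ha ha₀ hsum hs hδ
  have h4 := hsNormSq_le (Λ γ) Λ₀ hHS hΛ₀
  rw [Real.dist_eq]
  refine h3.trans_lt ?_
  rw [div_lt_iff₀ hc]
  have h5 : δ⁻¹ * hsNormSq (Λ γ - Λ₀) < c * ε / 2 := by
    rw [inv_mul_lt_iff₀ hδ]; exact h2
  have h6 : δ * (hsNormSq (Λ γ) + hsNormSq Λ₀) ≤ δ * (3 * hsNormSq Λ₀ + 2) :=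
    mul_le_mul_of_nonneg_left (by linarith) hδ.le
  linarith

/-- Dominated convergence for the matrix entries of `U K U - K` in a basis in which all `U γ` are
diagonal. -/
theorem tendsto_hsNormSq_conj {l : Filter ℝ} {b : HilbertBasis ι ℝ H} {u : ℝ → ι → ℝ}
    {U : ℝ → H →L[ℝ] H} {K : H →L[ℝ] H} (hK : IsHilbertSchmidt K)
    (hU : ∀ᶠ γ in l, IsDiag b (u γ) (U γ)) (hu : ∀ᶠ γ in l, ∀ i, 0 ≤ u γ i ∧ u γ i ≤ 1)
    (hlim : ∀ i, Tendsto (fun γ => u γ i) l (𝓝 1)) :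
    Tendsto (fun γ => hsNormSq (U γ * K * U γ - K)) l (𝓝 0) := by
  have hs := summable_matrix b b (hK.hasSum b).summable
  have h1 : Tendsto (fun γ => ∑' p : ι × ι, ((u γ p.2 * u γ p.1 - 1) * ⟪b p.2, K (b p.1)⟫_ℝ) ^ 2) l
      (𝓝 (∑' _ : ι × ι, (0 : ℝ))) := by
    refine tendsto_tsum_of_dominated_convergence hs (fun p => ?_) ?_
    · have := ((((hlim p.2).mul (hlim p.1)).sub_const 1).mul_const ⟪b p.2, K (b p.1)⟫_ℝ).pow 2
      simpa using this
    · filter_upwards [hu] with γ hγ p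
      obtain ⟨h2, h3⟩ := hγ p.2
      obtain ⟨h4, h5⟩ := hγ p.1
      rw [Real.norm_eq_abs, abs_of_nonneg (sq_nonneg _), mul_pow]
      refine mul_le_of_le_one_left (sq_nonneg _) ?_
      have h6 : u γ p.2 * u γ p.1 ≤ 1 := mul_le_one₀ h3 h4 h5
      have h7 : 0 ≤ u γ p.2 * u γ p.1 := mul_nonneg h2 h4
      nlinarith
  rw [tsum_zero] at h1
  refine h1.congr' ?_
  filter_upwards [hU] with γ hγ
  have hHS : IsHilbertSchmidt (U γ * K * U γ - K) := ((hK.mul_left _).mul_right _).sub hK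
  have h2 := summable_matrix b b (hHS.hasSum b).summable
  have h3 := h2.hasSum.prod_fiberwise fun i => hasSum_sq_inner b ((U γ * K * U γ - K) (b i))
  rw [(hHS.hasSum b).unique h3]
  refine tsum_congr fun p => ?_
  rw [sub_apply, mul_apply_eq_comp, mul_apply_eq_comp, hγ p.1, map_smul, map_smul, inner_sub_right,
    inner_smul_right, hγ.inner_apply]
  ring

end Continuity

/-! ### The divergence of a pair of similar operators -/

section Divergence

variable {H : Type u} [NormedAddCommGroup H] [InnerProductSpace ℝ H] [CompleteSpace H]
  {ι : Type*}

/-- When `Q⁻¹ P - 1` is similar to the self-adjoint trace class operator `U K U` with eigenvalues `a`,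
the divergence is the regularized log-determinant `∑ (aᵢ - log (1 + aᵢ))`. -/
theorem hasSum_logDetDiv (hdim : ¬ FiniteDimensional ℝ H) {P Q U K : H →L[ℝ] H} {γ : ℝ}
    (hγ : γ ≠ 0) (hP : scalarPart P = γ) (hQ : scalarPart Q = γ) (hU : IsHilbertSchmidt U)
    (hUsa : IsSelfAdjoint U) (J : (H →L[ℝ] H)ˣ)
    (hJ : Ring.inverse Q * P = 1 + J * (U * K * U) * (J⁻¹ : (H →L[ℝ] H)ˣ))
    {b : HilbertBasis ι ℝ H} {a : ι → ℝ} (hd : IsDiag b a (U * K * U))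
    {c : ℝ} (hc : 0 < c) (ha : ∀ i, c ≤ 1 + a i) :
    HasSum (fun i => a i - Real.log (1 + a i)) (logDetDiv P Q) := by
  have hHS : IsHilbertSchmidt (U * K * U) := hU.mul_left (U * K)
  have hsum : Summable a := by
    have h0 : Summable fun i => ‖K‖ * ‖U (b i)‖ ^ 2 := Summable.mul_left _ (hU.hasSum b).summable
    refine Summable.of_norm_bounded h0 fun i => ?_
    have h1 : a i = ⟪U (b i), K (U (b i))⟫_ℝ := by
      rw [hd.eigenvalue_eq, mul_apply_eq_comp, mul_apply_eq_comp]
      exact (hUsa.isSymmetric _ _).symm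
    rw [h1]
    refine (norm_inner_le_norm _ _).trans ?_
    nlinarith [K.le_opNorm (U (b i)), norm_nonneg (U (b i))]
  have hsub := summable_sub_log hc ha (hd.summable_sq hHS).summable
  have hlog : Summable fun i => Real.log (1 + a i) := by
    have h1 : Summable fun i => a i - (a i - Real.log (1 + a i)) := Summable.sub hsum hsub
    simpa only [sub_sub_cancel] using h1
  have e1 : (J * (U * K * U) * (J⁻¹ : (H →L[ℝ] H)ˣ) : H →L[ℝ] H) =
      (J * U * K) * (U * (J⁻¹ : (H →L[ℝ] H)ˣ)) := by simp only [mul_assoc]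
  have hX : IsHilbertSchmidt ((J : H →L[ℝ] H) * U * K) :=
    (hU.mul_left (J : H →L[ℝ] H)).mul_right K
  have hY : IsHilbertSchmidt (U * ((J⁻¹ : (H →L[ℝ] H)ˣ) : H →L[ℝ] H)) :=
    hU.mul_right ((J⁻¹ : (H →L[ℝ] H)ˣ) : H →L[ℝ] H)
  have hT : IsTraceClass (J * (U * K * U) * (J⁻¹ : (H →L[ℝ] H)ˣ) : H →L[ℝ] H) := by
    rw [e1]; exact hX.isTraceClass_mul hY
  have hT2 : IsHilbertSchmidt (J * (U * K * U) * (J⁻¹ : (H →L[ℝ] H)ˣ) : H →L[ℝ] H) := by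
    rw [e1]; exact hY.mul_left _
  have htr : opTrace (J * (U * K * U) * (J⁻¹ : (H →L[ℝ] H)ˣ) : H →L[ℝ] H) = ∑' i, a i := by
    unfold opTrace
    rw [e1, tsum_inner_mul_comm hX hY (onb H) b]
    have e2 : (U * ((J⁻¹ : (H →L[ℝ] H)ˣ) : H →L[ℝ] H)) * ((J : H →L[ℝ] H) * U * K) =
        U * (U * K) := by
      simp only [mul_assoc, J.inv_mul_cancel_left]
    rw [e2, tsum_inner_mul_comm hU (hU.mul_right K) b b]
    exact tsum_congr fun i => (hd.eigenvalue_eq i).symm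
  have hdet := fredholmDet_conj hd J (fun i => hc.trans_le (ha i)) hlog.hasSum
  have hs0 : scalarPart (Ring.inverse Q * P - 1) = 0 := by
    refine scalarPart_eq hdim ?_ ?_ <;> rw [hJ, add_sub_cancel_left, zero_smul, sub_zero]
    exacts [hT2, hT]
  have hs1 : scalarPart (Ring.inverse Q * P) = 1 := by
    refine scalarPart_eq hdim ?_ ?_ <;> rw [hJ, one_smul, add_sub_cancel_left]
    exacts [hT2, hT]
  have hval : logDetDiv P Q = ∑' i, a i - ∑' i, Real.log (1 + a i) := by
    rw [logDetDiv, extTrace, extDet, hP, hQ, hs0, hs1, div_self hγ, hJ, add_sub_cancel_left,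
      zero_smul, sub_zero, inv_one, one_smul, one_smul, add_sub_cancel_left, htr, hdet,
      one_mul, one_mul, Real.log_exp]
    ring
  rw [hval]
  exact HasSum.sub hsum.hasSum hlog.hasSum

theorem le_one_add_eigenvalue {K U : H →L[ℝ] H} {c α : ℝ} (hc1 : c ≤ 1)
    (hα : α ∈ Set.Icc (0 : ℝ) 1) (hK : ∀ x, c * ‖x‖ ^ 2 ≤ ⟪x, (1 + K) x⟫_ℝ)
    (hUsa : IsSelfAdjoint U) (hU : ∀ x, ‖U x‖ ≤ ‖x‖)
    {b : HilbertBasis ι ℝ H} {a : ι → ℝ} (hd : IsDiag b a (U * (α • K) * U)) (i : ι) :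
    c ≤ 1 + a i := by
  have h1 : a i = α * ⟪U (b i), K (U (b i))⟫_ℝ := by
    rw [hd.eigenvalue_eq, mul_apply_eq_comp, mul_apply_eq_comp, smul_apply, map_smul,
      inner_smul_right]
    congr 1
    exact (hUsa.isSymmetric _ _).symm
  have h2 := hK (U (b i))
  rw [add_apply, one_apply_eq_self, inner_add_right, real_inner_self_eq_norm_sq] at h2
  have h3 : ‖U (b i)‖ ^ 2 ≤ 1 := by
    have := pow_le_pow_left₀ (norm_nonneg _) (hU (b i)) 2
    rwa [norm_basis, one_pow] at this
  have h4 : -(1 - c) ≤ ⟪U (b i), K (U (b i))⟫_ℝ := by nlinarith [sq_nonneg ‖U (b i)‖]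
  rw [h1]
  nlinarith [mul_le_mul_of_nonneg_left h4 hα.1, hα.2]

/-- The polar decomposition `X = O Y` of an injective Hilbert-Schmidt operator with dense range: `O` is
orthogonal and `Y = |X|` is diagonal with positive eigenvalues. -/
theorem exists_polar {X : H →L[ℝ] H} (hX : IsHilbertSchmidt X) (hinj : ∀ x, X x = 0 → x = 0)
    (hinj' : ∀ x, ContinuousLinearMap.adjoint X x = 0 → x = 0) :
    ∃ (κ : Type u) (f : HilbertBasis κ ℝ H) (y : κ → ℝ) (Y : H →L[ℝ] H) (O : (H →L[ℝ] H)ˣ),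
      IsDiag f y Y ∧ (∀ i, 0 < y i) ∧ IsHilbertSchmidt Y ∧ X = O * Y ∧
        ContinuousLinearMap.adjoint X = Y * (O⁻¹ : (H →L[ℝ] H)ˣ) := by
  classical
  obtain ⟨κ, f, e, hf⟩ := (hX.mul_left (ContinuousLinearMap.adjoint X)).exists_isDiag
    (isSelfAdjoint_adjoint_mul_self X)
  have he : ∀ i, e i = ‖X (f i)‖ ^ 2 := fun i => by
    rw [hf.eigenvalue_eq, adjoint_mul_self_inner]
  have hpos : ∀ i, 0 < ‖X (f i)‖ := fun i =>
    norm_pos_iff.mpr fun h => basis_ne_zero f i (hinj _ h)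
  obtain ⟨Y, hY, -⟩ := exists_sqrt hf fun i => he i ▸ sq_nonneg _
  have hy : (fun i => √(e i)) = fun i => ‖X (f i)‖ := by
    funext i
    rw [he, Real.sqrt_sq (norm_nonneg _)]
  rw [hy] at hY
  let g : κ → H := fun i => ‖X (f i)‖⁻¹ • X (f i)
  have hg : Orthonormal ℝ g := by
    rw [orthonormal_iff_ite]
    intro i j
    have h1 : ⟪X (f i), X (f j)⟫_ℝ = e j * ⟪f i, f j⟫_ℝ := by
      rw [← ContinuousLinearMap.adjoint_inner_right, ← mul_apply_eq_comp, hf j,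
        inner_smul_right]
    simp only [g]
    rw [inner_smul_left, inner_smul_right, h1, inner_basis]
    by_cases hij : i = j
    · subst hij
      have hi := (hpos i).ne'
      simp only [if_true, he]
      simp
      field_simp
    · simp [hij]
  have hsp : (Submodule.span ℝ (Set.range g))ᗮ = ⊥ := by
    rw [Submodule.eq_bot_iff]
    intro x hx
    refine hinj' x (eq_of_forall_inner f fun i => ?_)
    have h1 : ⟪g i, x⟫_ℝ = 0 := hx _ (Submodule.subset_span ⟨i, rfl⟩)
    simp only [g] at h1
    rw [inner_smul_left] at h1
    rw [ContinuousLinearMap.adjoint_inner_right, inner_zero_right]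
    exact (mul_eq_zero.mp h1).resolve_left (by simpa using (hpos i).ne')
  let h := HilbertBasis.mkOfOrthogonalEqBot hg hsp
  have hh : ∀ i, h i = g i := fun i => by
    rw [HilbertBasis.coe_mkOfOrthogonalEqBot]
  let W : H ≃ₗᵢ[ℝ] H := f.repr.trans h.repr.symm
  have hW : ∀ i, W (f i) = g i := fun i => by
    rw [LinearIsometryEquiv.trans_apply, f.repr_self, h.repr_symm_single, hh]
  let O : (H →L[ℝ] H)ˣ :=
    ⟨(W.toContinuousLinearEquiv : H →L[ℝ] H), (W.symm.toContinuousLinearEquiv : H →L[ℝ] H),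
      by ext x; simp, by ext x; simp⟩
  have hXO : X = O * Y := by
    refine ext_hilbertBasis f fun i => ?_
    rw [mul_apply_eq_comp, hY i, map_smul]
    change _ = _ • W (f i)
    rw [hW, smul_smul, mul_inv_cancel₀ (hpos i).ne', one_smul]
  refine ⟨κ, f, fun i => ‖X (f i)‖, Y, O, hY, hpos, ?_, hXO, ?_⟩
  · refine isHilbertSchmidt_of_summable f ((hX.hasSum f).summable.congr fun i => ?_)
    rw [hY i, norm_smul, norm_norm, norm_basis, mul_one]
  · symm
    rw [ContinuousLinearMap.eq_adjoint_iff]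
    intro x z
    have h1 : X z = W (Y z) := by
      conv_lhs => rw [hXO]
      rfl
    have h2 : (Y * ((O⁻¹ : (H →L[ℝ] H)ˣ) : H →L[ℝ] H)) x = Y (W.symm x) := rfl
    have h3 : ⟪Y (W.symm x), z⟫_ℝ = ⟪W.symm x, Y z⟫_ℝ := hY.isSelfAdjoint.isSymmetric _ _
    rw [h1, h2, h3, ← W.inner_map_map, W.apply_symm_apply]

end Divergence

/-! ### Interpolated operators -/

section Interpolation

variable {H : Type u} [NormedAddCommGroup H] [InnerProductSpace ℝ H]

theorem inverse_sub_one_of_isUnit {R : Type*} [Ring R] {P : R} (hP : IsUnit P) :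
    Ring.inverse P - 1 = Ring.inverse P * (1 - P) := by
  rw [mul_sub, mul_one, Ring.inverse_mul_cancel P hP]

theorem inverse_inverse_of_isUnit {R : Type*} [MonoidWithZero R] {P : R} (hP : IsUnit P) :
    Ring.inverse (Ring.inverse P) = P := by
  obtain ⟨u, rfl⟩ := hP
  rw [Ring.inverse_unit, Ring.inverse_unit, inv_inv]

theorem interpS_comm (S₀ S₁ : H →L[ℝ] H) (α : ℝ) : interpS S₀ S₁ α = interpS S₁ S₀ (1 - α) := by
  rw [interpS, interpS, sub_sub_cancel, add_comm]

theorem interpC_comm (C₀ C₁ : H →L[ℝ] H) (α γ : ℝ) :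
    interpC C₀ C₁ α γ = interpC C₁ C₀ (1 - α) γ := by
  rw [interpC, interpC, sub_sub_cancel, add_comm]

variable [CompleteSpace H]

/-- `S_α` is Hilbert-Schmidt because `P⁻¹ - 1 = P⁻¹ (1 - P)` is one for `P = 1 - S₀` and
`P = 1 - S₁`, and again for the inverse of their convex combination. -/
theorem interpS_mem {S₀ S₁ : H →L[ℝ] H} (h₀ : S₀ ∈ SymHSLtOne H) (h₁ : S₁ ∈ SymHSLtOne H) {α : ℝ}
    (hα : α ∈ Set.Icc (0 : ℝ) 1) : interpS S₀ S₁ α ∈ SymHSLtOne H := by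
  have p₀ := SymHSLtOne.positiveDefinite h₀
  have p₁ := SymHSLtOne.positiveDefinite h₁
  have hN := p₀.inverse.convex p₁.inverse hα
  have hHS : ∀ S ∈ SymHSLtOne H, IsHilbertSchmidt (Ring.inverse (1 - S) - 1) := fun S hS => by
    rw [inverse_sub_one_of_isUnit (SymHSLtOne.positiveDefinite hS).isUnit, sub_sub_cancel]
    exact hS.2.1.mul_left _
  refine ⟨(IsSelfAdjoint.one _).sub hN.inverse.1, ?_, ?_⟩
  · set N := (1 - α) • Ring.inverse (1 - S₀) + α • Ring.inverse (1 - S₁) with hNdef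
    have e1 : N - 1 = (1 - α) • (Ring.inverse (1 - S₀) - 1) + α • (Ring.inverse (1 - S₁) - 1) := by
      simp only [hNdef, smul_sub, sub_smul, one_smul]
      abel
    have e : interpS S₀ S₁ α = Ring.inverse N *
        ((1 - α) • (Ring.inverse (1 - S₀) - 1) + α • (Ring.inverse (1 - S₁) - 1)) := by
      rw [← e1, mul_sub, mul_one, Ring.inverse_mul_cancel N hN.isUnit]
      rfl
    rw [e]
    exact (((hHS S₀ h₀).smul _).add ((hHS S₁ h₁).smul _)).mul_left _
  · rw [interpS, sub_sub_cancel]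
    exact hN.inverse.strictlyPositive

theorem isPositive_conj {B S : H →L[ℝ] H} (hB : IsSelfAdjoint B) (hS : S ∈ SymHSLtOne H) :
    (B * (1 - S) * B).IsPositive := by
  have p := SymHSLtOne.positiveDefinite hS
  rw [ContinuousLinearMap.isPositive_def']
  refine ⟨?_, fun x => ?_⟩
  · have := p.1.conjugate B
    rwa [hB.star_eq] at this
  · rw [ContinuousLinearMap.reApplyInnerSelf_apply, RCLike.re_to_real, real_inner_comm,
      mul_apply_eq_comp, mul_apply_eq_comp]
    have h1 : ⟪x, B ((1 - S) (B x))⟫_ℝ = ⟪B x, (1 - S) (B x)⟫_ℝ := (hB.isSymmetric _ _).symm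
    obtain ⟨-, M, hM, h⟩ := p
    rw [h1]
    exact (by positivity : (0 : ℝ) ≤ M * ‖B x‖ ^ 2).trans (h (B x))

theorem isPC1_add_smul_one {B S : H →L[ℝ] H} (hB : IsHilbertSchmidt B) (hBsa : IsSelfAdjoint B)
    (hS : S ∈ SymHSLtOne H) {γ : ℝ} (hγ : 0 < γ) : IsPC1 (B * (1 - S) * B + γ • 1) :=
  ⟨positiveDefinite_add_smul_one (isPositive_conj hBsa hS) hγ, γ, by
    rw [add_sub_cancel_right]
    exact (hB.mul_right (1 - S)).isTraceClass_mul hB⟩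

/-- `C_{α,γ} - γ` is a product of two Hilbert-Schmidt operators, because
`C_{α,γ}⁻¹ = γ⁻¹ (1 - Z B)` with `Z` Hilbert-Schmidt. -/
theorem interpC_spec {B S₀ S₁ : H →L[ℝ] H} (hB : IsHilbertSchmidt B) (hBsa : IsSelfAdjoint B)
    (h₀ : S₀ ∈ SymHSLtOne H) (h₁ : S₁ ∈ SymHSLtOne H) {α : ℝ} (hα : α ∈ Set.Icc (0 : ℝ) 1) {γ : ℝ}
    (hγ : 0 < γ) :
    PositiveDefinite (interpC (B * (1 - S₀) * B) (B * (1 - S₁) * B) α γ) ∧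
    IsHilbertSchmidt (interpC (B * (1 - S₀) * B) (B * (1 - S₁) * B) α γ - γ • 1) ∧
    IsTraceClass (interpC (B * (1 - S₀) * B) (B * (1 - S₁) * B) α γ - γ • 1) := by
  have p₀ := positiveDefinite_add_smul_one (isPositive_conj hBsa h₀) hγ
  have p₁ := positiveDefinite_add_smul_one (isPositive_conj hBsa h₁) hγ
  set P₀ := B * (1 - S₀) * B + γ • 1
  set P₁ := B * (1 - S₁) * B + γ • 1
  have hN := p₀.inverse.convex p₁.inverse hα
  have hinv : ∀ S P : H →L[ℝ] H, P = B * (1 - S) * B + γ • 1 → IsUnit P →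
      γ • Ring.inverse P = 1 - Ring.inverse P * B * (1 - S) * B := fun S P hP hu => by
    have h1 : Ring.inverse P * P = 1 := Ring.inverse_mul_cancel P hu
    have h2 : Ring.inverse P * P = Ring.inverse P * B * (1 - S) * B + γ • Ring.inverse P := by
      refine (congrArg (Ring.inverse P * ·) hP).trans ?_
      simp only [mul_add, mul_smul_comm, mul_one, mul_assoc]
    rw [eq_sub_iff_add_eq', ← h2, h1]
  have e₀ := hinv S₀ P₀ rfl p₀.isUnit
  have e₁ := hinv S₁ P₁ rfl p₁.isUnit
  set N := (1 - α) • Ring.inverse P₀ + α • Ring.inverse P₁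
  set Z : H →L[ℝ] H := (1 - α) • (Ring.inverse P₀ * B * (1 - S₀)) +
    α • (Ring.inverse P₁ * B * (1 - S₁))
  have hZ : IsHilbertSchmidt Z :=
    (((hB.mul_left (Ring.inverse P₀)).mul_right (1 - S₀)).smul (1 - α)).add
      (((hB.mul_left (Ring.inverse P₁)).mul_right (1 - S₁)).smul α)
  have hNZ : γ • N = 1 - Z * B := by
    have h1 : γ • N = (1 - α) • (γ • Ring.inverse P₀) + α • (γ • Ring.inverse P₁) := by
      rw [smul_add, smul_comm γ, smul_comm γ]
    rw [h1, e₀, e₁, smul_sub, smul_sub, add_mul, smul_mul_assoc, smul_mul_assoc, sub_smul, one_smul,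
      sub_smul]
    abel
  have hQ : interpC (B * (1 - S₀) * B) (B * (1 - S₁) * B) α γ = Ring.inverse N := rfl
  rw [hQ]
  have hkey : Ring.inverse N - γ • 1 = (Ring.inverse N * Z) * B := by
    have h1 : Ring.inverse N * (γ • N) = γ • 1 := by
      rw [mul_smul_comm, Ring.inverse_mul_cancel N hN.isUnit]
    rw [hNZ, mul_sub, mul_one] at h1
    rw [← h1, sub_sub_cancel, mul_assoc]
  refine ⟨hN.inverse, ?_, ?_⟩ <;> rw [hkey]
  · exact hB.mul_left _
  · exact (hZ.mul_left _).isTraceClass_mul hB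

theorem exists_unit_sqrt {S : H →L[ℝ] H} (hS : S ∈ SymHSLtOne H) :
    ∃ G : (H →L[ℝ] H)ˣ, IsSelfAdjoint (G : H →L[ℝ] H) ∧ (G : H →L[ℝ] H) * G = 1 - S := by
  have p := SymHSLtOne.positiveDefinite hS
  obtain ⟨κ, b, s, hb⟩ := hS.2.1.exists_isDiag hS.1
  have hd : IsDiag b (fun i => 1 + -s i) (1 - S) := by
    rw [sub_eq_add_neg]
    exact (isDiag_one b).add hb.neg
  obtain ⟨G, hG, hGG⟩ := exists_sqrt hd fun i => by
    rw [hd.eigenvalue_eq]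
    exact (p.strictlyPositive.2 _ (basis_ne_zero b i)).le
  have hu : IsUnit G := by
    have h1 : IsUnit (G ^ 2) := by rw [sq, hGG]; exact p.isUnit
    exact (isUnit_pow_iff two_ne_zero).mp h1
  obtain ⟨u, rfl⟩ := hu
  exact ⟨u, hG.isSelfAdjoint, hGG⟩

/-- The case `i = 0`, with `B` in the role of `C_*^{1/2}`. -/
theorem det2_pos_and_tendsto_logDetDiv (hdim : ¬ FiniteDimensional ℝ H) {B S₀ S₁ : H →L[ℝ] H}
    (hB : IsHilbertSchmidt B) (hBsa : IsSelfAdjoint B) (hBinj : ∀ x, B x = 0 → x = 0)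
    (h₀ : S₀ ∈ SymHSLtOne H) (h₁ : S₁ ∈ SymHSLtOne H) {α : ℝ} (hα : α ∈ Set.Icc (0 : ℝ) 1) :
    0 < det2 (Ring.inverse (1 - interpS S₀ S₁ α) * (1 - S₀)) ∧
    Tendsto (fun γ : ℝ => logDetDiv (B * (1 - S₀) * B + γ • 1)
        (interpC (B * (1 - S₀) * B) (B * (1 - S₁) * B) α γ)) (𝓝[>] 0)
      (𝓝 (-Real.log (det2 (Ring.inverse (1 - interpS S₀ S₁ α) * (1 - S₀))))) := by
  have p₀ := SymHSLtOne.positiveDefinite h₀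
  have p₁ := SymHSLtOne.positiveDefinite h₁
  obtain ⟨G, hGsa, hGG⟩ := exists_unit_sqrt h₁
  set Gi : H →L[ℝ] H := ((G⁻¹ : (H →L[ℝ] H)ˣ) : H →L[ℝ] H) with hGi
  have hGGi : (G : H →L[ℝ] H) * Gi = 1 := G.mul_inv
  have hGiG : Gi * (G : H →L[ℝ] H) = 1 := G.inv_mul
  have hGisa : IsSelfAdjoint Gi := by
    rw [hGi, ← Ring.inverse_unit]
    exact hGsa.ringInverse
  -- The operator with `1 - S₀ = G (1 + K) G`, where `G² = 1 - S₁`.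
  set K : H →L[ℝ] H := Gi * (S₁ - S₀) * Gi with hK
  have hKHS : IsHilbertSchmidt K := ((h₁.2.1.sub h₀.2.1).mul_left Gi).mul_right Gi
  have hKsa : IsSelfAdjoint K := by
    have := (h₁.1.sub h₀.1).conjugate Gi
    rwa [hGisa.star_eq] at this
  have hGK : (G : H →L[ℝ] H) * K * G = S₁ - S₀ := by
    calc (G : H →L[ℝ] H) * K * G = ((G : H →L[ℝ] H) * Gi) * (S₁ - S₀) * (Gi * G) := by
          simp only [hK, mul_assoc]
      _ = S₁ - S₀ := by rw [hGGi, hGiG, one_mul, mul_one]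
  have h1S₀ : (1 - S₀ : H →L[ℝ] H) = G * (1 + K) * G := by
    rw [mul_add, add_mul, mul_one, hGK, hGG]
    abel
  have h1K : (1 + K : H →L[ℝ] H) = Gi * (1 - S₀) * Gi := by
    rw [h1S₀]
    calc (1 + K : H →L[ℝ] H) = (Gi * G) * (1 + K) * (G * Gi) := by
          rw [hGGi, hGiG, one_mul, mul_one]
      _ = _ := by simp only [mul_assoc]
  obtain ⟨c, hc, hc1, hcK⟩ : ∃ c : ℝ, 0 < c ∧ c ≤ 1 ∧
      ∀ x, c * ‖x‖ ^ 2 ≤ ⟪x, (1 + K) x⟫_ℝ := by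
    obtain ⟨-, M, hM, hMx⟩ := p₀
    refine ⟨min 1 (M / (‖(G : H →L[ℝ] H)‖ ^ 2 + 1)), by positivity, min_le_left _ _, fun x => ?_⟩
    have e1 : ⟪x, (1 + K) x⟫_ℝ = ⟪Gi x, (1 - S₀) (Gi x)⟫_ℝ := by
      rw [h1K, mul_apply_eq_comp, mul_apply_eq_comp]
      exact (hGisa.isSymmetric _ _).symm
    have e2 : ‖x‖ ≤ ‖(G : H →L[ℝ] H)‖ * ‖Gi x‖ := by
      have := (G : H →L[ℝ] H).le_opNorm (Gi x)
      rwa [← mul_apply_eq_comp, hGGi, one_apply_eq_self] at this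
    have e3 : ‖x‖ ^ 2 ≤ (‖(G : H →L[ℝ] H)‖ ^ 2 + 1) * ‖Gi x‖ ^ 2 := by
      have := pow_le_pow_left₀ (norm_nonneg _) e2 2
      nlinarith [sq_nonneg ‖Gi x‖]
    rw [e1]
    refine le_trans ?_ (hMx (Gi x))
    calc min 1 (M / (‖(G : H →L[ℝ] H)‖ ^ 2 + 1)) * ‖x‖ ^ 2
        ≤ M / (‖(G : H →L[ℝ] H)‖ ^ 2 + 1) * ((‖(G : H →L[ℝ] H)‖ ^ 2 + 1) * ‖Gi x‖ ^ 2) :=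
          mul_le_mul (min_le_right _ _) e3 (sq_nonneg _) (by positivity)
      _ = M * ‖Gi x‖ ^ 2 := by field_simp
  -- The limiting determinant.
  obtain ⟨κ₀, b₀, a₀, hd₀⟩ := (hKHS.smul α).exists_isDiag ((IsSelfAdjoint.all α).smul hKsa)
  have hd₀' : IsDiag b₀ a₀ (1 * (α • K) * 1) := by rwa [one_mul, mul_one]
  have ha₀ : ∀ i, c ≤ 1 + a₀ i :=
    le_one_add_eigenvalue hc1 hα hcK (IsSelfAdjoint.one _) (fun _ => le_rfl) hd₀'
  have hs₀ := (summable_sub_log hc ha₀ (hd₀.summable_sq (hKHS.smul α)).summable).hasSum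
  have hS₁inv : Ring.inverse (1 - S₁) = Gi * Gi := by
    rw [← hGG, ← Units.val_mul, Ring.inverse_unit, mul_inv_rev, Units.val_mul]
  have hlimop : Ring.inverse (1 - interpS S₀ S₁ α) * (1 - S₀) =
      1 + ((G⁻¹ : (H →L[ℝ] H)ˣ) : H →L[ℝ] H) * (α • K) *
        (((G⁻¹)⁻¹ : (H →L[ℝ] H)ˣ) : H →L[ℝ] H) := by
    have h1 : Gi * Gi * (1 - S₀) = 1 + Gi * K * G := by
      rw [h1S₀]
      calc Gi * Gi * (G * (1 + K) * G) = Gi * (Gi * G) * (1 + K) * G := by simp only [mul_assoc]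
        _ = 1 + Gi * K * G := by rw [hGiG, mul_one, mul_add, mul_one, add_mul, hGiG]
    rw [interpS, sub_sub_cancel, inverse_inverse_of_isUnit (p₀.inverse.convex p₁.inverse hα).isUnit,
      add_mul, smul_mul_assoc, smul_mul_assoc, Ring.inverse_mul_cancel _ p₀.isUnit, hS₁inv, h1,
      inv_inv, mul_smul_comm, smul_mul_assoc, smul_add, sub_smul, one_smul]
    abel
  have hdet := det2_conj hd₀ G⁻¹ (fun i => hc.trans_le (ha₀ i)) hs₀
  rw [hlimop, hdet, Real.log_exp, neg_neg]
  refine ⟨Real.exp_pos _, ?_⟩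
  -- The common orthogonal change of coordinates: `B G = O Y`.
  have hadj : ContinuousLinearMap.adjoint (B * (G : H →L[ℝ] H)) = G * B := by
    rw [← ContinuousLinearMap.star_eq_adjoint, star_mul, hBsa.star_eq, hGsa.star_eq]
  have hGinj : ∀ x, (G : H →L[ℝ] H) x = 0 → x = 0 := fun x hx => by
    have : x = Gi ((G : H →L[ℝ] H) x) := by rw [← mul_apply_eq_comp, hGiG]; rfl
    rw [this, hx, map_zero]
  obtain ⟨κ, f, y, Y, O, hY, hy, hYHS, hX, hX'⟩ := exists_polar (hB.mul_right (G : H →L[ℝ] H))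
    (fun x hx => hGinj x (hBinj _ hx))
    (fun x hx => by rw [hadj] at hx; exact hBinj x (hGinj _ hx))
  rw [hadj] at hX'
  set Oi : H →L[ℝ] H := ((O⁻¹ : (H →L[ℝ] H)ˣ) : H →L[ℝ] H)
  have hOiO : Oi * (O : H →L[ℝ] H) = 1 := O.inv_mul
  have hOOi : (O : H →L[ℝ] H) * Oi = 1 := O.mul_inv
  have hC₁ : B * (1 - S₁) * B = O * (Y * Y) * Oi := by
    calc B * (1 - S₁) * B = (B * G) * (G * B) := by rw [← hGG]; simp only [mul_assoc]
      _ = _ := by rw [hX, hX']; simp only [mul_assoc]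
  have hC₀ : B * (1 - S₀) * B = O * (Y * (1 + K) * Y) * Oi := by
    calc B * (1 - S₀) * B = (B * G) * (1 + K) * (G * B) := by rw [h1S₀]; simp only [mul_assoc]
      _ = _ := by rw [hX, hX']; simp only [mul_assoc]
  have hγO : ∀ γ : ℝ, (γ • 1 : H →L[ℝ] H) = O * (γ • 1) * Oi := fun γ => by
    rw [mul_smul_comm, smul_mul_assoc, mul_one, hOOi]
  let u : ℝ → κ → ℝ := fun γ i => y i / √(y i ^ 2 + γ)
  have hu : ∀ γ, 0 < γ → ∀ i, 0 ≤ u γ i ∧ u γ i ≤ 1 := fun γ hγ i => by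
    refine ⟨div_nonneg (hy i).le (Real.sqrt_nonneg _), div_le_one_of_le₀ ?_ (Real.sqrt_nonneg _)⟩
    exact Real.le_sqrt_of_sq_le (by linarith)
  have hu1 : ∀ i, Tendsto (fun γ => u γ i) (𝓝[>] 0) (𝓝 1) := fun i => by
    have h1 : ContinuousAt (fun γ => u γ i) 0 := by
      refine ContinuousAt.div continuousAt_const (by fun_prop) ?_
      rw [add_zero, Real.sqrt_sq (hy i).le]
      exact (hy i).ne'
    have h2 : u 0 i = 1 := by
      simp only [u]
      rw [add_zero, Real.sqrt_sq (hy i).le, div_self (hy i).ne']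
    have h3 := h1.tendsto
    rw [h2] at h3
    exact h3.mono_left nhdsWithin_le_nhds
  have hex : ∀ γ : ℝ, ∃ U : H →L[ℝ] H, 0 < γ → IsDiag f (u γ) U := fun γ => by
    by_cases hγ : 0 < γ
    · obtain ⟨U, hU⟩ := exists_isDiag f (a := u γ) (M := 1) fun i => by
        rw [abs_of_nonneg (hu γ hγ i).1]
        exact (hu γ hγ i).2
      exact ⟨U, fun _ => hU⟩
    · exact ⟨0, fun h => absurd h hγ⟩
  choose U hU using hex
  have hpos : ∀ᶠ γ : ℝ in 𝓝[>] 0, 0 < γ := self_mem_nhdsWithin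
  refine tendsto_sum_sub_log (Λ := fun γ => U γ * (α • K) * U γ) hc (hKHS.smul α) hd₀ ha₀ hs₀ ?_
    (tendsto_hsNormSq_conj (b := f) (u := u) (hKHS.smul α) (hpos.mono hU) (hpos.mono hu) hu1)
  filter_upwards [hpos] with γ hγ
  have hUd := hU γ hγ
  have hΛHS : IsHilbertSchmidt (U γ * (α • K) * U γ) := ((hKHS.smul α).mul_left _).mul_right _
  refine ⟨hΛHS, ?_⟩
  have hΛsa : IsSelfAdjoint (U γ * (α • K) * U γ) := by
    have := ((IsSelfAdjoint.all α).smul hKsa).conjugate (U γ)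
    rwa [hUd.isSelfAdjoint.star_eq] at this
  obtain ⟨κ', b, a, hd⟩ := hΛHS.exists_isDiag hΛsa
  have ha : ∀ i, c ≤ 1 + a i :=
    le_one_add_eigenvalue hc1 hα hcK hUd.isSelfAdjoint (hUd.norm_apply_le (hu γ hγ)) hd
  refine ⟨κ', b, a, hd, ha, ?_⟩
  -- `D = (Y² + γ)^{1/2}`, so that `Y = U D = D U`.
  have hYpos : (Y * Y).IsPositive := (hY.mul hY).isPositive fun i => mul_self_nonneg _
  have hDD' := (hY.mul hY).add ((isDiag_one f).smul γ)
  obtain ⟨D, hD, hDD⟩ := exists_sqrt hDD' fun i =>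
    add_nonneg (mul_self_nonneg _) (by linarith)
  have hDu : IsUnit D := by
    have h1 : IsUnit (D ^ 2) := by
      rw [sq, hDD]; exact (positiveDefinite_add_smul_one hYpos hγ).isUnit
    exact (isUnit_pow_iff two_ne_zero).mp h1
  obtain ⟨D, rfl⟩ := hDu
  set Di : H →L[ℝ] H := ((D⁻¹ : (H →L[ℝ] H)ˣ) : H →L[ℝ] H)
  have hDiD : Di * (D : H →L[ℝ] H) = 1 := D.inv_mul
  have hDDi : (D : H →L[ℝ] H) * Di = 1 := D.mul_inv
  have hsq : ∀ i, √(y i * y i + γ * 1) = √(y i ^ 2 + γ) := fun i => by rw [mul_one, ← sq]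
  have hsq0 : ∀ i, √(y i ^ 2 + γ) ≠ 0 := fun i => (Real.sqrt_pos.mpr (by positivity)).ne'
  have hUD : U γ * (D : H →L[ℝ] H) = Y := by
    refine (hUd.mul hD).unique ?_
    have e : (fun i => u γ i * √(y i * y i + γ * 1)) = y := by
      funext i
      rw [hsq, div_mul_cancel₀ _ (hsq0 i)]
    rwa [e]
  have hDU : (D : H →L[ℝ] H) * U γ = Y := by
    refine (hD.mul hUd).unique ?_
    have e : (fun i => √(y i * y i + γ * 1) * u γ i) = y := by
      funext i
      rw [hsq, mul_div_cancel₀ _ (hsq0 i)]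
    rwa [e]
  have hUHS : IsHilbertSchmidt (U γ) := by
    have : U γ = Y * Di := by rw [← hUD, mul_assoc, hDDi, mul_one]
    rw [this]
    exact hYHS.mul_right _
  have hP₁ : B * (1 - S₁) * B + γ • 1 = O * (D * D) * Oi := by
    rw [hC₁, hγO γ, hDD, mul_add, add_mul]
  have hP₀ : B * (1 - S₀) * B + γ • 1 = O * (D * (1 + U γ * K * U γ) * D) * Oi := by
    have h1 : (D : H →L[ℝ] H) * (1 + U γ * K * U γ) * D = D * D + Y * K * Y := by
      rw [mul_add, add_mul, mul_one]
      congr 1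
      calc (D : H →L[ℝ] H) * (U γ * K * U γ) * D = (D * U γ) * K * (U γ * D) := by
            simp only [mul_assoc]
        _ = _ := by rw [hUD, hDU]
    rw [hC₀, hγO γ, h1, hDD, ← add_mul, ← mul_add, mul_add Y, mul_one, add_mul]
    congr 2
    abel
  have q₀ := positiveDefinite_add_smul_one (isPositive_conj hBsa h₀) hγ
  have q₁ := positiveDefinite_add_smul_one (isPositive_conj hBsa h₁) hγ
  obtain ⟨-, hQHS, hQtr⟩ := interpC_spec hB hBsa h₀ h₁ hα hγ
  refine hasSum_logDetDiv hdim hγ.ne' ?_ (scalarPart_eq hdim hQHS hQtr) hUHS hUd.isSelfAdjoint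
    (O * D⁻¹) ?_ hd hc ha
  · refine scalarPart_eq hdim ?_ ?_ <;> rw [add_sub_cancel_right]
    · exact hB.mul_left _
    · exact (hB.mul_right (1 - S₀)).isTraceClass_mul hB
  · have h1 : Ring.inverse (B * (1 - S₁) * B + γ • 1) = O * (Di * Di) * Oi := by
      have : (O * (D * D) * Oi : H →L[ℝ] H) = ((O * (D * D) * O⁻¹ : (H →L[ℝ] H)ˣ) : H →L[ℝ] H) := by
        simp [Oi]
      rw [hP₁, this, Ring.inverse_unit]
      simp [Oi, Di, mul_assoc]
    have h2 : Ring.inverse (B * (1 - S₁) * B + γ • 1) * (B * (1 - S₀) * B + γ • 1) =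
        1 + (O * Di) * (U γ * K * U γ) * (D * Oi) := by
      rw [h1, hP₀]
      calc (O * (Di * Di) * Oi * (O * (D * (1 + U γ * K * U γ) * D) * Oi) : H →L[ℝ] H)
          = O * Di * (Di * (Oi * O) * D) * (1 + U γ * K * U γ) * (D * Oi) := by
            simp only [mul_assoc]
        _ = O * (Di * D) * Oi + O * Di * (U γ * K * U γ) * (D * Oi) := by
            rw [hOiO, mul_one, hDiD, mul_one, mul_add, mul_one, add_mul, mul_assoc (O : H →L[ℝ] H),
              ← mul_assoc Di, hDiD, one_mul, mul_one]
        _ = _ := by rw [hDiD, mul_one, hOOi]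
    have hJi : (((O * D⁻¹)⁻¹ : (H →L[ℝ] H)ˣ) : H →L[ℝ] H) = D * Oi := by
      rw [mul_inv_rev, inv_inv, Units.val_mul]
    rw [interpC, inverse_inverse_of_isUnit (q₀.inverse.convex q₁.inverse hα).isUnit, add_mul,
      smul_mul_assoc, smul_mul_assoc, Ring.inverse_mul_cancel _ q₀.isUnit, h2, hJi, Units.val_mul,
      mul_smul_comm, smul_mul_assoc, mul_smul_comm, smul_mul_assoc, smul_add, sub_smul, one_smul]
    abel

end Interpolation

end GeoJS

theorem mainTheorem11
    {H : Type*} [NormedAddCommGroup H] [InnerProductSpace ℝ H] [CompleteSpace H]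
    [TopologicalSpace.SeparableSpace H] [MeasurableSpace H] [BorelSpace H]
    (hdim : ¬ FiniteDimensional ℝ H)
    -- the reference measure `μ_* = 𝒩(m_*, C_*)`, with `C_* ∈ Sym⁺⁺(H) ∩ Tr(H)`
    (μs : Measure H) (ms : H) (Cs : H →L[ℝ] H)
    (hμs : GeoJS.IsGaussianWith μs ms Cs)
    (hCs_pos : GeoJS.StrictlyPositive Cs) (hCs_tr : GeoJS.IsTraceClass Cs)
    -- `μ_i = 𝒩(m_i, C_i) ∈ Gauss(H, μ_*)` with `C_i = C_*^{1/2} (I - S_i) C_*^{1/2}`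
    (μ : Fin 2 → Measure H) (m : Fin 2 → H) (C S : Fin 2 → H →L[ℝ] H)
    (hμ : ∀ i, GeoJS.IsGaussianWith (μ i) (m i) (C i))
    (hμ_equiv : ∀ i, μ i ∈ GeoJS.gaussEquiv μs)
    (hS : ∀ i, S i ∈ GeoJS.SymHSLtOne H)
    (hC : ∀ i, C i = GeoJS.opSqrt Cs * (1 - S i) * GeoJS.opSqrt Cs)
    (α : ℝ) (hα : α ∈ Set.Icc (0 : ℝ) 1) :
    GeoJS.interpS (S 0) (S 1) α ∈ GeoJS.SymHSLtOne H ∧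
    (∀ γ : ℝ, 0 < γ → GeoJS.IsPC1 (GeoJS.interpC (C 0) (C 1) α γ)) ∧
    ∀ i : Fin 2,
      (∀ γ : ℝ, 0 < γ → GeoJS.IsPC1 (C i + γ • 1)) ∧
      0 < GeoJS.det2 (Ring.inverse (1 - GeoJS.interpS (S 0) (S 1) α) * (1 - S i)) ∧
      Tendsto
        (fun γ : ℝ => GeoJS.logDetDiv (C i + γ • 1) (GeoJS.interpC (C 0) (C 1) α γ))
        (𝓝[>] 0)
        (𝓝 (-Real.log
          (GeoJS.det2 (Ring.inverse (1 - GeoJS.interpS (S 0) (S 1) α) * (1 - S i))))) := by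
  have hCs : Cs.IsPositive := by
    rw [ContinuousLinearMap.isPositive_def']
    refine ⟨hCs_pos.1, fun x => ?_⟩
    rw [ContinuousLinearMap.reApplyInnerSelf_apply, RCLike.re_to_real, real_inner_comm]
    rcases eq_or_ne x 0 with rfl | hx
    · simp
    · exact (hCs_pos.2 x hx).le
  obtain ⟨hBpos, hBB, hB⟩ := GeoJS.opSqrt_of_isTraceClass hCs hCs_tr
  set B := GeoJS.opSqrt Cs
  have hBsa := hBpos.isSelfAdjoint
  have hBinj : ∀ x, B x = 0 → x = 0 := fun x hx => by
    by_contra hne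
    have h1 := hCs_pos.2 x hne
    rw [← hBB, mul_apply_eq_comp, hx, map_zero, inner_zero_right] at h1
    exact lt_irrefl _ h1
  have hα' : 1 - α ∈ Set.Icc (0 : ℝ) 1 := ⟨by linarith [hα.2], by linarith [hα.1]⟩
  have key₀ := GeoJS.det2_pos_and_tendsto_logDetDiv hdim hB hBsa hBinj (hS 0) (hS 1) hα
  have key₁ := GeoJS.det2_pos_and_tendsto_logDetDiv hdim hB hBsa hBinj (hS 1) (hS 0) hα'
  simp only [← GeoJS.interpS_comm, ← GeoJS.interpC_comm, ← hC] at key₀ key₁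
  refine ⟨GeoJS.interpS_mem (hS 0) (hS 1) hα, fun γ hγ => ?_, fun i => ⟨fun γ hγ => ?_, ?_⟩⟩
  · obtain ⟨h1, -, h2⟩ := GeoJS.interpC_spec hB hBsa (hS 0) (hS 1) hα hγ
    rw [← hC, ← hC] at h1 h2
    exact ⟨h1, γ, h2⟩
  · rw [hC]
    exact GeoJS.isPC1_add_smul_one hB hBsa (hS i) hγ
  · fin_cases i
    exacts [key₀, key₁]
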